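/- Conventions. A model category has all small limits and colimits, and its factorizations are not required to be functorial; it is proper if weak equivalences are stable under pushout along cofibrations and under pullback along fibrations. For a category $\mathcal C$, the category $\mathrm{pro}\text{-}\mathcal C$ has as objects the diagrams in $\mathcal C$ indexed by small (non-empty) cofiltering categories, with $\mathrm{Hom}(X,Y)=\lim_i\operatorname{colim}_j \mathrm{Hom}_{\mathcal C}(X_j,Y_i)$; a constant pro-object is one indexed by the one-morphism category. A map of $\mathrm{pro}\text{-}\mathcal C$ is essentially levelwise in a class $W$ of maps of $\mathcal C$ if it is isomorphic, as a map, to one given by a natural transformation, with all components in $W$, between two diagrams with the same small cofiltering index category. In the strict model structure on $\mathrm{pro}\text{-}\mathcal C$ the weak equivalences (cofibrations) are the essentially levelwise weak equivalences (cofibrations), and the fibrations are the maps with the right lifting property with respect to all maps that are both cofibrations and weak equivalences. For a class $I$ of maps in a category, let $I\text{-inj}$ be the class of maps with the right lifting property with respect to $I$, and $I\text{-cof}$ the class of maps with the left lifting property with respect to $I\text{-inj}$. The class $I$ permits the non-functorial version of the generalized small object argument if 1. there is a cardinal $\kappa$ such that every domain $A$ of a map in $I$ is $\kappa$-small relative to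 $I\text{-cof}$: for every limit ordinal $\lambda$ in which every subset of cardinality $\le\kappa$ is bounded, and every colimit-preserving $\lambda$-sequence $Z$ whose maps $Z_\beta\to Z_{\beta+1}$ lie in $I\text{-cof}$, the map $\operatorname{colim}_\beta \mathrm{Hom}(A,Z_\beta)\to \mathrm{Hom}(A,\operatorname{colim}_\beta Z_\beta)$ is bijective; 2. for every map $f$ there are a map $S(f)\in I\text{-cof}$ and a morphism of maps $t_f\colon S(f)\to f$ such that every morphism of maps $i\to f$ with $i\in I$ factors through $t_f$. A class $M$ of maps admits the non-functorial version of the generalized cosmall object argument if $M$, viewed as a class of maps in the opposite category, satisfies 1 and 2. A model category is class-fibrantly generated by classes $M$ (generating fibrations) and $N$ (generating trivial fibrations) if $M$ and $N$ admit this argument, a map is a trivial cofibration if and only if it has the left lifting property with respect to every element of $M$, and a map is a cofibration if and only if it has the left lifting property with respect to every element of $N$. **Theorem.** Let $\mathcal C$ be a proper model category. Then the strict model structure on $\mathrm{pro}\text{-}\mathcal C$ exists, i.e. $\mathrm{pro}\text{-}\mathcal C$ with the above weak equivalences, cofibrations and fibrations is a model category, with all small limits and colimits. It is class-fibrantly generated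 by the class $M$ of constant fibrations and the class $N$ of constant trivial fibrations (the fibrations, respectively trivial fibrations, of $\mathcal C$, viewed as maps between constant pro-objects). In particular, the classes $M$ and $N$ admit the non-functorial version of the generalized cosmall object argument. -/

import Mathlib

open CategoryTheory CategoryTheory.Limits HomotopicalAlgebra
open Opposite (op)

universe w v u

/-! ### Pro-categories -/

/-- A pro-object of `C`: a diagram in `C` indexed by a small cofiltering category. -/
structure Pro (C : Type u) [Category.{v} C] where
  /-- the indexing category -/
  Index : Type v
  [category : SmallCategory Index]
  [isCofiltered : IsCofiltered Index]
  /-- the diagram -/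
  diagram : Index ⥤ C

namespace Pro

attribute [instance] Pro.category Pro.isCofiltered

variable {C : Type u} [Category.{v} C]

/-- `X.Germ A` is the set `colim_j Hom_C (X_j, A)`, the colimit being taken over the opposite
of the indexing category of `X`. -/
def Germ (X : Pro C) (A : C) : Type v :=
  (X.diagram.op ⋙ yoneda.obj A).ColimitType

/-- The class in `colim_j Hom_C (X_j, A)` of a morphism `X_j ⟶ A`. -/
def Germ.mk {X : Pro C} {A : C} (j : X.Index) (φ : X.diagram.obj j ⟶ A) : X.Germ A :=
  (X.diagram.op ⋙ yoneda.obj A).ιColimitType (op j) φ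

/-- Restricting `X_j ⟶ A` along a bonding map `X_j' ⟶ X_j` does not change its class. -/
theorem Germ.mk_map {X : Pro C} {A : C} {j j' : X.Index} (u : j' ⟶ j)
    (φ : X.diagram.obj j ⟶ A) :
    (Germ.mk j' (X.diagram.map u ≫ φ) : X.Germ A) = Germ.mk j φ :=
  (Quot.sound ⟨u.op, rfl⟩).symm

theorem Germ.exists_rep {X : Pro C} {A : C} (x : X.Germ A) :
    ∃ (j : X.Index) (φ : X.diagram.obj j ⟶ A), Germ.mk j φ = x := by
  induction x using Quot.inductionOn with
  | h p => exact ⟨p.1.unop, p.2, rfl⟩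

/-- A function out of `colim_j Hom_C (X_j, A)`. -/
def Germ.lift {X : Pro C} {A : C} {T : Type w} (F : ∀ j : X.Index, (X.diagram.obj j ⟶ A) → T)
    (hF : ∀ {j j' : X.Index} (u : j' ⟶ j) (φ : X.diagram.obj j ⟶ A),
      F j' (X.diagram.map u ≫ φ) = F j φ) (x : X.Germ A) : T :=
  Quot.lift (fun p => F p.1.unop p.2) (by
    rintro ⟨j, φ⟩ ⟨j', φ'⟩ ⟨u, hu⟩
    dsimp at u hu ⊢
    subst hu
    exact (hF u.unop φ).symm) x

/-- Postcomposition `colim_j Hom_C (X_j, A) → colim_j Hom_C (X_j, B)` with `a : A ⟶ B`. -/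
def Germ.map {X : Pro C} {A B : C} (a : A ⟶ B) : X.Germ A → X.Germ B :=
  Germ.lift (fun j φ => Germ.mk j (φ ≫ a)) (by
    intro j j' u φ
    rw [Category.assoc, Germ.mk_map])

@[simp]
theorem Germ.map_mk {X : Pro C} {A B : C} (a : A ⟶ B) (j : X.Index)
    (φ : X.diagram.obj j ⟶ A) :
    Germ.map a (Germ.mk j φ : X.Germ A) = Germ.mk j (φ ≫ a) := rfl

theorem Germ.map_map {X : Pro C} {A B D : C} (a : A ⟶ B) (b : B ⟶ D) (x : X.Germ A) :
    Germ.map b (Germ.map a x) = Germ.map (a ≫ b) x := by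
  obtain ⟨j, φ, rfl⟩ := x.exists_rep
  simp

/-- A pro-morphism `X ⟶ Y`: an element of `lim_i colim_j Hom_C (X_j, Y_i)`, i.e. a family
of elements of the sets `colim_j Hom_C (X_j, Y_i)` that is compatible with the bonding
maps of `Y`. -/
@[ext]
structure Hom (X Y : Pro C) where
  /-- the components -/
  app (i : Y.Index) : X.Germ (Y.diagram.obj i)
  compat {i i' : Y.Index} (u : i ⟶ i') : Germ.map (Y.diagram.map u) (app i) = app i'

/-- The function `colim_i Hom_C (Y_i, A) → colim_j Hom_C (X_j, A)` induced by a pro-morphism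
`X ⟶ Y`: it sends the class of `φ : Y_i ⟶ A` to the image of the `i`-th component under `φ`. -/
def Hom.comapGerm {X Y : Pro C} (f : Hom X Y) {A : C} : Y.Germ A → X.Germ A :=
  Germ.lift (fun i φ => Germ.map φ (f.app i)) (by
    intro i i' u φ
    rw [← Germ.map_map, f.compat])

@[simp]
theorem Hom.comapGerm_mk {X Y : Pro C} (f : Hom X Y) {A : C} (i : Y.Index)
    (φ : Y.diagram.obj i ⟶ A) :
    f.comapGerm (Germ.mk i φ) = Germ.map φ (f.app i) := rfl

theorem Hom.map_comapGerm {X Y : Pro C} (f : Hom X Y) {A B : C} (a : A ⟶ B) (y : Y.Germ A) :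
    Germ.map a (f.comapGerm y) = f.comapGerm (Germ.map a y) := by
  obtain ⟨i, φ, rfl⟩ := y.exists_rep
  simp [Germ.map_map]

/-- The category `pro-C`. -/
instance : Category.{v} (Pro C) where
  Hom X Y := Hom X Y
  id X :=
    { app := fun i => Germ.mk i (𝟙 _)
      compat := by
        intro i i' u
        rw [Germ.map_mk, Category.id_comp, ← Germ.mk_map u (𝟙 _), Category.comp_id] }
  comp {X Y Z} f g :=
    { app := fun k => Hom.comapGerm f (Hom.app g k)
      compat := by
        intro k k' u
        rw [Hom.map_comapGerm, Hom.compat] }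
  id_comp {X Y} f := by
    refine Hom.ext (funext fun i => ?_)
    obtain ⟨j, φ, h⟩ := (Hom.app f i).exists_rep
    simp [← h]
  comp_id {X Y} f := by
    refine Hom.ext (funext fun i => ?_)
    obtain ⟨j, φ, h⟩ := (Hom.app f i).exists_rep
    simp [← h]
  assoc {W X Y Z} f g h := by
    refine Hom.ext (funext fun i => ?_)
    obtain ⟨k, φ, e⟩ := (Hom.app h i).exists_rep
    simp [← e, Hom.map_comapGerm]

/-- The level morphism of pro-objects given by a natural transformation between two diagrams
with the same small cofiltering indexing category. -/
def levelMap {I : Type v} [SmallCategory I] [IsCofiltered I] {F G : I ⥤ C} (α : F ⟶ G) :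
    (Pro.mk I F : Pro C) ⟶ Pro.mk I G :=
  show Hom _ _ from
  { app := fun i => Germ.mk (X := Pro.mk I F) i (α.app i)
    compat := by
      intro i i' u
      rw [Germ.map_mk, ← Germ.mk_map (X := Pro.mk I F) u (α.app i')]
      exact congrArg _ (α.naturality u).symm }

/-- The constant pro-objects, indexed by the category with one object and one morphism. -/
def const (C : Type u) [Category.{v} C] : C ⥤ Pro C where
  obj A := Pro.mk (Discrete PUnit.{v + 1}) ((Functor.const _).obj A)
  map f := levelMap ((Functor.const _).map f)
  map_id _ := rfl
  map_comp _ _ := rfl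

/-- A morphism of `pro-C` is essentially levelwise in `W` if it is isomorphic, in the category
of morphisms of `pro-C`, to a level morphism all of whose components belong to `W`. -/
def essentiallyLevelwise (W : MorphismProperty C) : MorphismProperty (Pro C) :=
  fun _ _ f => ∃ (I : Type v) (_ : SmallCategory I) (_ : IsCofiltered I) (F G : I ⥤ C)
    (α : F ⟶ G), (∀ i, W (α.app i)) ∧ Nonempty (Arrow.mk f ≅ Arrow.mk (levelMap α))

/-- A model structure on `pro-C` is the strict one if its weak equivalences (resp. cofibrations)
are the essentially levelwise weak equivalences (resp. cofibrations), and its fibrations are the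
morphisms with the right lifting property with respect to all trivial cofibrations. -/
structure IsStrictModelStructure (C : Type u) [Category.{v} C] [ModelCategory C]
    (S : ModelCategory (Pro C)) : Prop where
  weakEquivalences_eq :
    weakEquivalences (Pro C) = essentiallyLevelwise (weakEquivalences C)
  cofibrations_eq :
    cofibrations (Pro C) = essentiallyLevelwise (cofibrations C)
  fibrations_eq :
    fibrations (Pro C) = (essentiallyLevelwise (cofibrations C) ⊓
      essentiallyLevelwise (weakEquivalences C)).rlp

/-- The class of constant fibrations: the fibrations of `C`, viewed as morphisms
between constant pro-objects. -/
def constantFibrations (C : Type u) [Category.{v} C] [ModelCategory C] :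
    MorphismProperty (Pro C) :=
  (fibrations C).strictMap (const C)

/-- The class of constant trivial fibrations: the trivial fibrations of `C`, viewed as morphisms
between constant pro-objects. -/
def constantTrivialFibrations (C : Type u) [Category.{v} C] [ModelCategory C] :
    MorphismProperty (Pro C) :=
  (trivialFibrations C).strictMap (const C)

end Pro

/-! ### Proper model categories -/

/-- A model category is proper if weak equivalences are stable under pushouts along cofibrations
and under pullbacks along fibrations. -/
class IsProperModelCategory (C : Type u) [Category.{v} C] [ModelCategory C] : Prop where
  left_proper {A X B P : C} {i : A ⟶ X} {f : A ⟶ B} {g : X ⟶ P} {j : B ⟶ P}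
    (sq : IsPushout i f g j) (hi : cofibrations C i) (hf : weakEquivalences C f) :
    weakEquivalences C g
  right_proper {P X Y B : C} {g : P ⟶ X} {q : P ⟶ Y} {p : X ⟶ B} {f : Y ⟶ B}
    (sq : IsPullback g q p f) (hp : fibrations C p) (hf : weakEquivalences C f) :
    weakEquivalences C g

/-! ### The generalized small object argument -/

namespace GeneralizedSmallObject

/-- A well-ordered type `J` without maximal element (a limit ordinal) is `κ`-filtered if every
subset of cardinality at most `κ` is bounded (has supremum strictly below the ordinal). -/
def IsKappaFiltered (κ : Cardinal.{w}) (J : Type w) [LinearOrder J] : Prop :=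
  NoMaxOrder J ∧ ∀ s : Set J, Cardinal.mk s ≤ κ → BddAbove s

variable {D : Type u} [Category.{v} D]

/-- `A` is `κ`-small relative to a class `W` of morphisms: for every `κ`-filtered ordinal `J` and
every `J`-sequence `F` (a functor `J ⥤ D` that is continuous at limit elements) all of whose
successor maps belong to `W`, the map `colim_j Hom (A, F_j) → Hom (A, colim_j F_j)` is
bijective. Small means `v`-small, where `v` is the universe of the morphisms of `D`. -/
def IsKappaSmallRelativeTo (κ : Cardinal.{v}) (A : D) (W : MorphismProperty D) : Prop :=
  ∀ (J : Type v) [LinearOrder J] [OrderBot J] [SuccOrder J] [WellFoundedLT J],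
    IsKappaFiltered κ J → ∀ (F : J ⥤ D) [F.IsWellOrderContinuous],
      (∀ j : J, W (F.map (homOfLE (Order.le_succ j)))) →
        PreservesColimit F (coyoneda.obj (op A))

/-- The class `I` permits the non-functorial version of the generalized small object argument.
Here `I.rlp.llp` is the class `I-cof` of morphisms with the left lifting property with respect
to every morphism that has the right lifting property with respect to `I`. -/
structure PermitsSmallObjectArgument (I : MorphismProperty D) : Prop where
  exists_small : ∃ κ : Cardinal.{v}, ∀ ⦃A B : D⦄ (i : A ⟶ B), I i →
    IsKappaSmallRelativeTo κ A I.rlp.llp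
  exists_factorization : ∀ f : Arrow D, ∃ (s : Arrow D) (t : s ⟶ f), I.rlp.llp s.hom ∧
    ∀ i : Arrow D, I i.hom → ∀ φ : i ⟶ f, ∃ ψ : i ⟶ s, ψ ≫ t = φ

/-- The dual notion: the class `M` admits the non-functorial version of the generalized cosmall
object argument. -/
def PermitsCosmallObjectArgument (M : MorphismProperty D) : Prop :=
  PermitsSmallObjectArgument M.op

/-- The model category `D` is class-cofibrantly generated, with class `I` of generating
cofibrations and class `J` of generating trivial cofibrations. (The functorial version of the
generalized small object argument is stronger than the non-functorial one used here.) -/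
structure IsClassCofibrantlyGeneratedBy (D : Type u) [Category.{v} D] [ModelCategory D]
    (I J : MorphismProperty D) : Prop where
  permits_left : PermitsSmallObjectArgument I
  trivialFibrations_eq : trivialFibrations D = I.rlp
  permits_right : PermitsSmallObjectArgument J
  fibrations_eq : fibrations D = J.rlp

/-- The dual notion: the model category `D` is class-fibrantly generated, with class `M` of
generating fibrations and class `N` of generating trivial fibrations, i.e. the opposite model
category is class-cofibrantly generated. -/
def IsClassFibrantlyGeneratedBy (D : Type u) [Category.{v} D] [ModelCategory D]
    (M N : MorphismProperty D) : Prop :=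
  IsClassCofibrantlyGeneratedBy Dᵒᵖ M.op N.op

end GeneralizedSmallObject

/-!
The strict model structure on `pro-C`, for a proper model category `C`.

The argument rests on a description of essentially levelwise morphisms by factorizations: a
pro-morphism `f` is essentially levelwise in `W` if and only if every morphism from `f` to an arrow
of `C`, in the category of arrows of `pro-C`, factors through an arrow of `C` that belongs to `W`
(`Pro.FactorsThrough`, `Pro.essentiallyLevelwise_iff`). For the nontrivial direction, the arrows of
`C` under `f` form a cofiltered category, and a small family of arrows in `W` which is weakly
initial in it indexes a level morphism isomorphic to `f` (`Pro.nonempty_iso_levelMap`). No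
reindexing by cofinite directed sets is needed, and most closure properties become short diagram
chases in `C`:

* retracts of essentially levelwise morphisms are essentially levelwise;
* if `(L, R)` is a weak factorization system of `C`, then being essentially levelwise in `L` is the
  left lifting property against the constant morphisms in `R` (`Pro.factorsThrough_eq_llp`);
* essentially levelwise weak equivalences have the two-out-of-three property, by properness;
* a morphism that is essentially levelwise a cofibration and essentially levelwise a weak
  equivalence is essentially levelwise a trivial cofibration.

Limits and colimits of pro-objects come from the equivalence between the opposite of `pro-C` and the
category of ind-objects of the opposite of `C`; it also shows that constant pro-objects are
cocompact. Hence both factorizations are produced by a countable cosmall object argument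
(`Pro.exists_factorization`): if `g : X ⟶ Z` is a pro-morphism, every square from `g` to a constant
morphism factors through one of the set of arrows `X_i ⟶ Z_j` representing `g`, so that it suffices
to factor these in `C` and to pull back the product of their right parts to `Z`. Such a base change
is a cofiltered limit of base changes of constant morphisms, and therefore essentially levelwise in
`R`; so is the limit of the tower (`Pro.factorsThrough_of_isLimit`). This gives the remaining fact,
that a morphism with the right lifting property against all essentially levelwise cofibrations is a
weak equivalence (`Pro.llp_rlp_le_factorsThrough`). The factorizations also provide the maps
required by the generalized cosmall object argument.
-/

namespace Pro

variable {C : Type u} [Category.{v} C]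

/-! ### Morphisms to constant pro-objects -/

theorem Germ.mk_eq_mk_iff {X : Pro C} {A : C} {i j : X.Index} (φ : X.diagram.obj i ⟶ A)
    (ψ : X.diagram.obj j ⟶ A) :
    (Germ.mk i φ : X.Germ A) = Germ.mk j ψ ↔
      ∃ (k : X.Index) (a : k ⟶ i) (b : k ⟶ j),
        X.diagram.map a ≫ φ = X.diagram.map b ≫ ψ := by
  constructor
  · intro h
    obtain ⟨k, a, b, hab⟩ := (Functor.ιColimitType_eq_iff_of_isFiltered _ _ _).1 h
    exact ⟨k.unop, a.unop, b.unop, hab⟩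
  · rintro ⟨k, a, b, hab⟩
    rw [← Germ.mk_map a, hab, Germ.mk_map]

/-- The morphism to a constant pro-object given by an element of `colim_j Hom_C (X_j, A)`. -/
def ofGerm {X : Pro C} {A : C} (x : X.Germ A) : X ⟶ (const C).obj A :=
  show Hom _ _ from
  { app := fun _ => x
    compat := by
      intro i i' a
      obtain ⟨j, φ, rfl⟩ := x.exists_rep
      exact congrArg (Germ.mk j) (Category.comp_id φ) }

/-- The element of `colim_j Hom_C (X_j, A)` given by a morphism to a constant pro-object. -/
def toGerm {X : Pro C} {A : C} (f : X ⟶ (const C).obj A) : X.Germ A :=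
  Hom.app f ⟨PUnit.unit⟩

@[simp]
theorem toGerm_ofGerm {X : Pro C} {A : C} (x : X.Germ A) : toGerm (ofGerm x) = x := rfl

@[simp]
theorem ofGerm_toGerm {X : Pro C} {A : C} (f : X ⟶ (const C).obj A) :
    ofGerm (toGerm f) = f := rfl

theorem toGerm_injective {X : Pro C} {A : C} :
    Function.Injective (toGerm : (X ⟶ (const C).obj A) → X.Germ A) :=
  fun f g h => by rw [← ofGerm_toGerm f, h, ofGerm_toGerm]

@[simp]
theorem toGerm_comp_map {X : Pro C} {A B : C} (f : X ⟶ (const C).obj A) (a : A ⟶ B) :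
    toGerm (f ≫ (const C).map a) = Germ.map a (toGerm f) := rfl

theorem toGerm_comp {X Y : Pro C} {A : C} (f : X ⟶ Y) (g : Y ⟶ (const C).obj A) :
    toGerm (f ≫ g) = Hom.comapGerm f (toGerm g) := rfl

/-- The projection of a pro-object to its `i`-th term. -/
def proj (X : Pro C) (i : X.Index) : X ⟶ (const C).obj (X.diagram.obj i) :=
  ofGerm (Germ.mk i (𝟙 _))

theorem toGerm_proj_map {X : Pro C} (i : X.Index) {A : C} (φ : X.diagram.obj i ⟶ A) :
    toGerm (X.proj i ≫ (const C).map φ) = Germ.mk i φ := by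
  simp [proj]

theorem toGerm_comp_proj {X Y : Pro C} (f : X ⟶ Y) (i : Y.Index) :
    toGerm (f ≫ Y.proj i) = Hom.app f i := by
  obtain ⟨j, φ, h⟩ := (Hom.app f i).exists_rep
  simp [toGerm_comp, proj, ← h]

@[simp]
theorem proj_map (X : Pro C) {i j : X.Index} (a : i ⟶ j) :
    X.proj i ≫ (const C).map (X.diagram.map a) = X.proj j := by
  apply toGerm_injective
  rw [toGerm_proj_map]
  exact (congrArg _ (Category.comp_id _).symm).trans (Germ.mk_map a (𝟙 _))

@[simp]
theorem proj_map_assoc (X : Pro C) {i j : X.Index} (a : i ⟶ j) {Z : Pro C}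
    (h : (const C).obj (X.diagram.obj j) ⟶ Z) :
    X.proj i ≫ (const C).map (X.diagram.map a) ≫ h = X.proj j ≫ h := by
  rw [← Category.assoc, proj_map]

theorem exists_proj_map {X : Pro C} {A : C} (f : X ⟶ (const C).obj A) :
    ∃ (i : X.Index) (φ : X.diagram.obj i ⟶ A), f = X.proj i ≫ (const C).map φ := by
  obtain ⟨i, φ, h⟩ := (toGerm f).exists_rep
  exact ⟨i, φ, toGerm_injective (by rw [toGerm_proj_map, h])⟩

theorem proj_map_eq_iff {X : Pro C} {A : C} {i j : X.Index} (φ : X.diagram.obj i ⟶ A)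
    (ψ : X.diagram.obj j ⟶ A) :
    X.proj i ≫ (const C).map φ = X.proj j ≫ (const C).map ψ ↔
      ∃ (k : X.Index) (a : k ⟶ i) (b : k ⟶ j),
        X.diagram.map a ≫ φ = X.diagram.map b ≫ ψ := by
  rw [← Germ.mk_eq_mk_iff, ← toGerm_proj_map, ← toGerm_proj_map, toGerm_injective.eq_iff]

/-- Two morphisms to constant pro-objects are represented at a common stage. -/
theorem exists_proj_map₂ {X : Pro C} {A B : C} (f : X ⟶ (const C).obj A)
    (g : X ⟶ (const C).obj B) :
    ∃ (i : X.Index) (φ : X.diagram.obj i ⟶ A) (ψ : X.diagram.obj i ⟶ B),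
      f = X.proj i ≫ (const C).map φ ∧ g = X.proj i ≫ (const C).map ψ := by
  obtain ⟨i, φ, rfl⟩ := exists_proj_map f
  obtain ⟨j, ψ, rfl⟩ := exists_proj_map g
  exact ⟨IsCofiltered.min i j, X.diagram.map (IsCofiltered.minToLeft i j) ≫ φ,
    X.diagram.map (IsCofiltered.minToRight i j) ≫ ψ, by simp, by simp⟩

/-- Two morphisms out of a stage that agree on the pro-object agree on an earlier stage. -/
theorem exists_map_comp_eq {X : Pro C} {A : C} {i : X.Index} {φ ψ : X.diagram.obj i ⟶ A}
    (h : X.proj i ≫ (const C).map φ = X.proj i ≫ (const C).map ψ) :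
    ∃ (k : X.Index) (a : k ⟶ i), X.diagram.map a ≫ φ = X.diagram.map a ≫ ψ := by
  obtain ⟨k, a, b, hab⟩ := (proj_map_eq_iff _ _).1 h
  refine ⟨IsCofiltered.eq a b, IsCofiltered.eqHom a b ≫ a, ?_⟩
  rw [X.diagram.map_comp, Category.assoc, hab, ← Category.assoc, ← X.diagram.map_comp,
    ← IsCofiltered.eq_condition, X.diagram.map_comp]

theorem hom_ext {T X : Pro C} {f g : T ⟶ X} (h : ∀ i, f ≫ X.proj i = g ≫ X.proj i) : f = g :=
  Hom.ext (funext fun i => by rw [← toGerm_comp_proj, h, toGerm_comp_proj])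

/-- A morphism to a pro-object is a compatible family of morphisms to its terms. -/
def lift {T X : Pro C} (f : ∀ i, T ⟶ (const C).obj (X.diagram.obj i))
    (hf : ∀ {i j : X.Index} (a : i ⟶ j), f i ≫ (const C).map (X.diagram.map a) = f j) :
    T ⟶ X :=
  show Hom _ _ from
  { app := fun i => toGerm (f i)
    compat := by
      intro i j a
      rw [← toGerm_comp_map, hf] }

@[simp]
theorem lift_proj {T X : Pro C} (f : ∀ i, T ⟶ (const C).obj (X.diagram.obj i))
    (hf : ∀ {i j : X.Index} (a : i ⟶ j), f i ≫ (const C).map (X.diagram.map a) = f j)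
    (i : X.Index) : lift f hf ≫ X.proj i = f i :=
  toGerm_injective (toGerm_comp_proj _ _)

@[simp]
theorem lift_proj_assoc {T X : Pro C} (f : ∀ i, T ⟶ (const C).obj (X.diagram.obj i))
    (hf : ∀ {i j : X.Index} (a : i ⟶ j), f i ≫ (const C).map (X.diagram.map a) = f j)
    (i : X.Index) {Z : Pro C} (h : (const C).obj (X.diagram.obj i) ⟶ Z) :
    lift f hf ≫ X.proj i ≫ h = f i ≫ h := by
  rw [← Category.assoc, lift_proj]

@[simp]
theorem levelMap_proj {I : Type v} [SmallCategory I] [IsCofiltered I] {F G : I ⥤ C} (α : F ⟶ G)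
    (i : I) : levelMap α ≫ (Pro.mk I G).proj i = (Pro.mk I F).proj i ≫ (const C).map (α.app i) := by
  apply toGerm_injective
  rw [toGerm_comp_proj]
  exact (toGerm_proj_map (X := Pro.mk I F) i (α.app i)).symm

@[simp]
theorem levelMap_proj_assoc {I : Type v} [SmallCategory I] [IsCofiltered I] {F G : I ⥤ C}
    (α : F ⟶ G) (i : I) {Z : Pro C} (h : (const C).obj (G.obj i) ⟶ Z) :
    levelMap α ≫ (Pro.mk I G).proj i ≫ h =
      (Pro.mk I F).proj i ≫ (const C).map (α.app i) ≫ h := by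
  rw [← Category.assoc, levelMap_proj, Category.assoc]

/-- A morphism of pro-objects inducing bijections on morphisms to constant pro-objects is an
isomorphism. -/
theorem isIso_of_bijective {X Y : Pro C} (f : X ⟶ Y)
    (h : ∀ A : C, Function.Bijective (fun u : Y ⟶ (const C).obj A => f ≫ u)) : IsIso f := by
  choose g hg using fun j : X.Index => (h _).2 (X.proj j)
  refine ⟨lift g ?_, hom_ext ?_, hom_ext ?_⟩
  · intro i j a
    apply (h _).1
    have := hg i
    have := hg j
    simp_all [← Category.assoc]
  · intro i
    simpa using hg i
  · intro i
    apply (h _).1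
    obtain ⟨j, φ, hφ⟩ := exists_proj_map (f ≫ Y.proj i)
    simp only [Category.assoc, lift_proj_assoc, Category.id_comp, hφ]
    exact (Category.assoc _ _ _).symm.trans (congrArg (· ≫ (const C).map φ) (hg j))

/-! ### Limits and colimits of pro-objects -/

/-- The arrows from a pro-object to constant ones form a cofiltered category, so that forming
constant pro-objects preserves finite limits. -/
instance : RepresentablyFlat (const C) where
  cofiltered X :=
    { nonempty := by
        obtain ⟨i⟩ := (IsCofiltered.nonempty : Nonempty X.Index)
        exact ⟨StructuredArrow.mk (X.proj i)⟩
      cone_objs := by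
        intro f g
        obtain ⟨i, φ, ψ, hφ, hψ⟩ := exists_proj_map₂ f.hom g.hom
        exact ⟨StructuredArrow.mk (X.proj i), StructuredArrow.homMk φ hφ.symm,
          StructuredArrow.homMk ψ hψ.symm, trivial⟩
      cone_maps := by
        intro f g a b
        obtain ⟨i, φ, hφ⟩ := exists_proj_map f.hom
        have hab : X.proj i ≫ (const C).map (φ ≫ a.right) =
            X.proj i ≫ (const C).map (φ ≫ b.right) := by
          rw [Functor.map_comp, Functor.map_comp, ← Category.assoc, ← Category.assoc, ← hφ,
            StructuredArrow.w, StructuredArrow.w]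
        obtain ⟨k, c, hc⟩ := exists_map_comp_eq hab
        refine ⟨StructuredArrow.mk (X.proj k),
          StructuredArrow.homMk (X.diagram.map c ≫ φ) (by simp [hφ]), ?_⟩
        ext
        simpa using hc }

instance : PreservesFiniteLimits (const C) := preservesFiniteLimits_of_flat _

variable (C) in
/-- The functor sending a pro-object `X` to the functor `A ↦ Hom (X, A) = colim_j Hom_C (X_j, A)`
on `C`, written as a presheaf on `Cᵒᵖ`. -/
def toPresheaf : (Pro C)ᵒᵖ ⥤ Cᵒᵖᵒᵖ ⥤ Type v :=
  coyoneda ⋙ (Functor.whiskeringLeft _ _ _).obj (unopUnop C ⋙ const C)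

instance : (toPresheaf C).Faithful where
  map_injective {X Y} f g h := by
    apply Quiver.Hom.unop_inj
    refine hom_ext fun i => ?_
    exact congrArg (fun τ => τ.app (op (op (X.unop.diagram.obj i))) (X.unop.proj i)) h

/-- A natural transformation is determined by its values on the projections of the source. -/
instance : (toPresheaf C).Full where
  map_surjective {X Y} τ := by
    have nat {A B : C} (u : X.unop ⟶ (const C).obj A) (a : A ⟶ B) :
        τ.app (op (op B)) (u ≫ (const C).map a) = τ.app (op (op A)) u ≫ (const C).map a :=
      congrArg (fun t => t u) (τ.naturality a.op.op)
    have compat {i j : X.unop.Index} (a : i ⟶ j) :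
        τ.app (op (op (X.unop.diagram.obj i))) (X.unop.proj i) ≫
          (const C).map (X.unop.diagram.map a) =
            τ.app (op (op (X.unop.diagram.obj j))) (X.unop.proj j) := by
      rw [← nat, proj_map]
    refine ⟨(lift _ compat).op, ?_⟩
    ext A u
    obtain ⟨i, φ, rfl⟩ := exists_proj_map (show X.unop ⟶ (const C).obj A.unop.unop from u)
    refine Eq.trans ?_ (nat _ _).symm
    exact lift_proj_assoc _ compat _ _

/-- The presheaf attached to a pro-object is the colimit of the presheaves represented by its
terms. -/
def toPresheafCocone (X : Pro C) : Cocone (X.diagram.op ⋙ yoneda) where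
  pt := (toPresheaf C).obj (op X)
  ι :=
    { app i := yonedaEquiv.symm (X.proj i.unop)
      naturality i j a := by
        ext A (φ : A.unop ⟶ op (X.diagram.obj i.unop))
        change X.proj j.unop ≫ (const C).map (X.diagram.map a.unop ≫ φ.unop) =
          X.proj i.unop ≫ (const C).map φ.unop
        simp }

/-- `toPresheafCocone` is a colimit cocone. -/
noncomputable def isColimitToPresheafCocone (X : Pro C) : IsColimit (toPresheafCocone X) :=
  evaluationJointlyReflectsColimits _ fun A => Types.FilteredColimit.isColimitOf _ _
    (by
      intro u
      obtain ⟨i, φ, h⟩ := exists_proj_map (show X ⟶ (const C).obj A.unop.unop from u)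
      exact ⟨op i, φ.op, h⟩)
    (by
      intro i j φ ψ h
      obtain ⟨k, a, b, hab⟩ := (proj_map_eq_iff _ _).1
        (show X.proj i.unop ≫ (const C).map φ.unop = X.proj j.unop ≫ (const C).map ψ.unop from h)
      exact ⟨op k, a.op, b.op, congrArg Quiver.Hom.op hab⟩)

theorem isIndObject_toPresheaf (X : (Pro C)ᵒᵖ) : IsIndObject ((toPresheaf C).obj X) :=
  IsIndObject.mk
    { I := X.unop.Indexᵒᵖ
      F := X.unop.diagram.op
      ι := (toPresheafCocone X.unop).ι
      isColimit := isColimitToPresheafCocone X.unop }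

theorem exists_iso_toPresheaf {G : Cᵒᵖᵒᵖ ⥤ Type v} (hG : IsIndObject G) :
    ∃ X, Nonempty ((toPresheaf C).obj X ≅ G) := by
  obtain ⟨P⟩ := hG.nonempty_presentation
  let X : Pro C := ⟨P.Iᵒᵖ, P.F.leftOp⟩
  have h : IsColimit ((toPresheafCocone X).whisker (opOp P.I)) :=
    (Functor.Final.isColimitWhiskerEquiv _ _).symm (isColimitToPresheafCocone X)
  exact ⟨op X, ⟨h.coconePointUniqueUpToIso P.isColimit⟩⟩

variable (C) in
/-- The functor from the opposite of `pro-C` to the category of ind-objects of the opposite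
of `C`. -/
def toIndObject : (Pro C)ᵒᵖ ⥤ ObjectProperty.FullSubcategory (IsIndObject (C := Cᵒᵖ)) :=
  ObjectProperty.lift _ (toPresheaf C) isIndObject_toPresheaf

instance : (toIndObject C).Faithful := inferInstanceAs (ObjectProperty.lift _ _ _).Faithful

instance : (toIndObject C).Full := inferInstanceAs (ObjectProperty.lift _ _ _).Full

instance : (toIndObject C).EssSurj where
  mem_essImage G := by
    obtain ⟨X, ⟨e⟩⟩ := exists_iso_toPresheaf G.property
    exact ⟨X, ⟨(ObjectProperty.fullyFaithfulι _).preimageIso e⟩⟩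

instance : (toIndObject C).IsEquivalence where

variable (C) in
/-- The functor from the opposite of `pro-C` to `Ind Cᵒᵖ`. -/
noncomputable def toInd : (Pro C)ᵒᵖ ⥤ Ind Cᵒᵖ := toIndObject C ⋙ (Ind.equivalence Cᵒᵖ).inverse

instance : (toInd C).IsEquivalence :=
  inferInstanceAs (toIndObject C ⋙ (Ind.equivalence Cᵒᵖ).inverse).IsEquivalence

theorem hasLimits [HasFiniteLimits C] : HasLimits (Pro C) :=
  have : HasColimits (Pro C)ᵒᵖ := Adjunction.has_colimits_of_equivalence (toInd C)
  hasLimits_of_hasColimits_op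

theorem hasColimits [HasColimits C] : HasColimits (Pro C) :=
  have : HasLimits (Pro C)ᵒᵖ := Adjunction.has_limits_of_equivalence (toInd C)
  hasColimits_of_hasLimits_op

/-- The morphisms to a constant pro-object, as a functor on `(pro-C)ᵒᵖ`, are the evaluation at
this object of the attached presheaf. -/
def coyonedaConstIso (A : C) : coyoneda.obj (op (op ((const C).obj A))) ≅
    toIndObject C ⋙ ObjectProperty.ι _ ⋙ (evaluation _ _).obj (op (op A)) :=
  NatIso.ofComponents (fun Y => (opEquiv _ _).toIso) (by intros; rfl)

instance (A : C) (J : Type*) [Category J] [EssentiallySmall.{v} J] [IsFiltered J] :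
    PreservesColimitsOfShape J (coyoneda.obj (op (op ((const C).obj A)))) :=
  have : IsFiltered (SmallModel.{v} J) := IsFiltered.of_equivalence (equivSmallModel J)
  have := preservesColimitsOfShape_of_natIso (J := SmallModel.{v} J) (coyonedaConstIso A).symm
  preservesColimitsOfShape_of_equiv (equivSmallModel J).symm _

section CofilteredLimits

variable {J : Type*} [Category J] [EssentiallySmall.{v} J] [IsCofiltered J] {F : J ⥤ Pro C}
  {c : Cone F}

/-- Constant pro-objects are cocompact: a morphism from a cofiltered limit to a constant
pro-object factors through one of the terms. -/
theorem exists_fac_of_isLimit (hc : IsLimit c) {A : C} (u : c.pt ⟶ (const C).obj A) :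
    ∃ (j : J) (t : F.obj j ⟶ (const C).obj A), u = c.π.app j ≫ t := by
  have h := isColimitOfPreserves (coyoneda.obj (op (op ((const C).obj A)))) hc.op
  obtain ⟨j, t, ht⟩ := Types.jointly_surjective_of_isColimit h u.op
  exact ⟨j.unop, t.unop, congrArg Quiver.Hom.unop ht.symm⟩

/-- Constant pro-objects are cocompact: two morphisms from a term that agree on a cofiltered
limit agree on an earlier term. -/
theorem exists_map_comp_eq_of_isLimit (hc : IsLimit c) {A : C} {j : J}
    {s t : F.obj j ⟶ (const C).obj A} (hst : c.π.app j ≫ s = c.π.app j ≫ t) :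
    ∃ (k : J) (a : k ⟶ j), F.map a ≫ s = F.map a ≫ t := by
  have h := isColimitOfPreserves (coyoneda.obj (op (op ((const C).obj A)))) hc.op
  obtain ⟨k, a, hk⟩ := (Types.FilteredColimit.isColimit_eq_iff' h s.op t.op).1
    (congrArg Quiver.Hom.op hst)
  exact ⟨k.unop, a.unop, congrArg Quiver.Hom.unop hk⟩

end CofilteredLimits

/-! ### A criterion for being essentially levelwise -/

/-- Every morphism from `f` to an arrow of `C` factors, in the category of arrows of `pro-C`,
through an arrow of `C` that belongs to `W`. -/
def FactorsThrough (W : MorphismProperty C) : MorphismProperty (Pro C) :=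
  fun X Y f => ∀ ⦃A B : C⦄ (a : A ⟶ B) (u : X ⟶ (const C).obj A) (s : Y ⟶ (const C).obj B),
    u ≫ (const C).map a = f ≫ s →
      ∃ (A' B' : C) (w : A' ⟶ B') (u' : X ⟶ (const C).obj A') (s' : Y ⟶ (const C).obj B')
        (p : A' ⟶ A) (q : B' ⟶ B), W w ∧ u' ≫ (const C).map w = f ≫ s' ∧ p ≫ a = w ≫ q ∧
          u' ≫ (const C).map p = u ∧ s' ≫ (const C).map q = s

instance (W : MorphismProperty C) : (FactorsThrough W).IsStableUnderRetracts where
  of_retract {X Y Z T f g} h hg A B a u s hus := by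
    obtain ⟨A', B', w, u', s', p, q, hw, h₁, h₂, h₃, h₄⟩ :=
      hg a (h.r.left ≫ u) (h.r.right ≫ s) (by
        rw [Category.assoc, hus]
        exact Arrow.w_assoc h.r s)
    refine ⟨A', B', w, h.i.left ≫ u', h.i.right ≫ s', p, q, hw, ?_, h₂, ?_, ?_⟩
    · rw [Category.assoc, h₁]
      exact Arrow.w_assoc h.i s'
    · rw [Category.assoc, h₃, RetractArrow.retract_left_assoc]
      exact Category.id_comp u
    · rw [Category.assoc, h₄, RetractArrow.retract_right_assoc]
      exact Category.id_comp s

theorem factorsThrough_levelMap {W : MorphismProperty C} {I : Type v} [SmallCategory I]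
    [IsCofiltered I] {F G : I ⥤ C} (α : F ⟶ G) (hα : ∀ i, W (α.app i)) :
    FactorsThrough W (levelMap α) := by
  intro A B a u s hus
  obtain ⟨i, φ, rfl⟩ := exists_proj_map u
  obtain ⟨j, ψ, rfl⟩ := exists_proj_map s
  dsimp at i j φ ψ
  have h : (Pro.mk I F).proj i ≫ (const C).map (φ ≫ a) =
      (Pro.mk I F).proj j ≫ (const C).map (α.app j ≫ ψ) := by
    simpa using hus
  obtain ⟨k, b, d, hk⟩ := (proj_map_eq_iff (X := Pro.mk I F) _ _).1 h
  dsimp at k b d hk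
  refine ⟨F.obj k, G.obj k, α.app k, (Pro.mk I F).proj k, (Pro.mk I G).proj k,
    F.map b ≫ φ, G.map d ≫ ψ, hα k, (levelMap_proj α k).symm, by simpa using hk, ?_, ?_⟩
  · rw [Functor.map_comp]
    exact proj_map_assoc (Pro.mk I F) b _
  · rw [Functor.map_comp]
    exact proj_map_assoc (Pro.mk I G) d _

theorem factorsThrough_of_essentiallyLevelwise {W : MorphismProperty C} {X Y : Pro C} {f : X ⟶ Y}
    (hf : essentiallyLevelwise W f) : FactorsThrough W f := by
  obtain ⟨I, _, _, F, G, α, hα, ⟨e⟩⟩ := hf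
  exact ((FactorsThrough W).arrow_mk_iso_iff e).2 (factorsThrough_levelMap α hα)

/-- The category of morphisms from a morphism `f` of `pro-C` to arrows of `C`. -/
abbrev ArrowUnder {X Y : Pro C} (f : X ⟶ Y) : Type (max u v) :=
  StructuredArrow (Arrow.mk f) (const C).mapArrow

namespace ArrowUnder

variable {X Y : Pro C} {f : X ⟶ Y}

/-- The object of `ArrowUnder f` given by a commutative square. -/
def mk {A B : C} (a : A ⟶ B) (u : X ⟶ (const C).obj A)
    (s : Y ⟶ (const C).obj B) (h : u ≫ (const C).map a = f ≫ s) : ArrowUnder f :=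
  StructuredArrow.mk (Y := Arrow.mk a) (Arrow.homMk (f := Arrow.mk f)
    (g := (const C).mapArrow.obj (Arrow.mk a)) u s h)

/-- The component `X ⟶ A` of a morphism from `f : X ⟶ Y` to `A ⟶ B`. -/
abbrev homLeft (x : ArrowUnder f) : X ⟶ (const C).obj x.right.left := x.hom.left

/-- The component `Y ⟶ B` of a morphism from `f : X ⟶ Y` to `A ⟶ B`. -/
abbrev homRight (x : ArrowUnder f) : Y ⟶ (const C).obj x.right.right := x.hom.right

theorem w (x : ArrowUnder f) : x.homLeft ≫ (const C).map x.right.hom = f ≫ x.homRight :=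
  Arrow.w x.hom

/-- A morphism of `ArrowUnder f` is a commutative square compatible with the morphisms
from `f`. -/
def homMk {x y : ArrowUnder f} (p : x.right.left ⟶ y.right.left)
    (q : x.right.right ⟶ y.right.right) (h : p ≫ y.right.hom = x.right.hom ≫ q)
    (hp : x.homLeft ≫ (const C).map p = y.homLeft)
    (hq : x.homRight ≫ (const C).map q = y.homRight) : x ⟶ y :=
  StructuredArrow.homMk (Arrow.homMk p q h) (Arrow.hom_ext _ _ hp hq)

theorem homLeft_map {x y : ArrowUnder f} (t : x ⟶ y) :
    x.homLeft ≫ (const C).map t.right.left = y.homLeft :=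
  congrArg (fun z => z.left) (StructuredArrow.w t)

theorem homRight_map {x y : ArrowUnder f} (t : x ⟶ y) :
    x.homRight ≫ (const C).map t.right.right = y.homRight :=
  congrArg (fun z => z.right) (StructuredArrow.w t)

theorem hom_ext {x y : ArrowUnder f} {t t' : x ⟶ y} (h₁ : t.right.left = t'.right.left)
    (h₂ : t.right.right = t'.right.right) : t = t' :=
  StructuredArrow.hom_ext _ _ (Arrow.hom_ext _ _ h₁ h₂)

variable [HasFiniteLimits C]

instance : IsCofiltered (ArrowUnder f) where
  nonempty := by
    have h := terminalIsTerminal.isTerminalObj (const C) _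
    exact ⟨mk (𝟙 (⊤_ C)) (h.from X) (h.from Y) (h.hom_ext _ _)⟩
  cone_objs x y := by
    have hA := isLimitOfHasBinaryProductOfPreservesLimit (const C) x.right.left y.right.left
    have hB := isLimitOfHasBinaryProductOfPreservesLimit (const C) x.right.right y.right.right
    obtain ⟨u, hu₁, hu₂⟩ := BinaryFan.IsLimit.lift' hA x.homLeft y.homLeft
    obtain ⟨s, hs₁, hs₂⟩ := BinaryFan.IsLimit.lift' hB x.homRight y.homRight
    dsimp at u hu₁ hu₂ s hs₁ hs₂
    have hus : u ≫ (const C).map (prod.map x.right.hom y.right.hom) = f ≫ s := by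
      refine BinaryFan.IsLimit.hom_ext hB ?_ ?_
      · have := x.w
        dsimp at this ⊢
        rw [Category.assoc, Category.assoc, hs₁, ← Functor.map_comp, prod.map_fst,
          Functor.map_comp, ← Category.assoc, hu₁, this]
      · have := y.w
        dsimp at this ⊢
        rw [Category.assoc, Category.assoc, hs₂, ← Functor.map_comp, prod.map_snd,
          Functor.map_comp, ← Category.assoc, hu₂, this]
    exact ⟨mk _ u s hus, homMk prod.fst prod.fst (prod.map_fst _ _).symm hu₁ hs₁,
      homMk prod.snd prod.snd (prod.map_snd _ _).symm hu₂ hs₂, trivial⟩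
  cone_maps x y t t' := by
    have hA := isLimitOfHasEqualizerOfPreservesLimit (const C) t.right.left t'.right.left
    have hB := isLimitOfHasEqualizerOfPreservesLimit (const C) t.right.right t'.right.right
    obtain ⟨u, hu⟩ := Fork.IsLimit.lift' hA x.homLeft (by rw [homLeft_map, homLeft_map])
    obtain ⟨s, hs⟩ := Fork.IsLimit.lift' hB x.homRight (by rw [homRight_map, homRight_map])
    dsimp at u hu s hs
    let a : equalizer t.right.left t'.right.left ⟶ equalizer t.right.right t'.right.right :=
      equalizer.lift (equalizer.ι _ _ ≫ x.right.hom) (by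
        rw [Category.assoc, Category.assoc, ← Arrow.w t.right, ← Arrow.w t'.right,
          equalizer.condition_assoc])
    have ha : a ≫ equalizer.ι _ _ = equalizer.ι _ _ ≫ x.right.hom := equalizer.lift_ι _ _
    have hus : u ≫ (const C).map a = f ≫ s := by
      refine Fork.IsLimit.hom_ext hB ?_
      have := x.w
      dsimp at this ⊢
      rw [Category.assoc, Category.assoc, hs, ← Functor.map_comp, ha, Functor.map_comp,
        ← Category.assoc, hu, this]
    exact ⟨mk a u s hus, homMk (equalizer.ι _ _) (equalizer.ι _ _) ha.symm hu hs,
      hom_ext (equalizer.condition _ _) (equalizer.condition _ _)⟩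

end ArrowUnder

/-- The squares from `f` to morphisms between its terms, which represent `f`. -/
structure TermSquare {X Y : Pro C} (f : X ⟶ Y) where
  /-- the stage of the source -/
  i : X.Index
  /-- the stage of the target -/
  j : Y.Index
  /-- a representative of the `j`-th component of the pro-morphism -/
  hom : X.diagram.obj i ⟶ Y.diagram.obj j
  w : X.proj i ≫ (const C).map hom = f ≫ Y.proj j

/-- Every morphism from `f` to an arrow of `C` factors through a morphism between its terms. -/
theorem TermSquare.exists_fac {X Y : Pro C} {f : X ⟶ Y} {A B : C} {a : A ⟶ B}
    {u : X ⟶ (const C).obj A} {s : Y ⟶ (const C).obj B} (h : u ≫ (const C).map a = f ≫ s) :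
    ∃ (x : TermSquare f) (p : X.diagram.obj x.i ⟶ A) (q : Y.diagram.obj x.j ⟶ B),
      p ≫ a = x.hom ≫ q ∧ X.proj x.i ≫ (const C).map p = u ∧
        Y.proj x.j ≫ (const C).map q = s := by
  obtain ⟨j, q, rfl⟩ := exists_proj_map s
  obtain ⟨i, p, φ, rfl, hφ⟩ := exists_proj_map₂ u (f ≫ Y.proj j)
  have h' : X.proj i ≫ (const C).map (p ≫ a) = X.proj i ≫ (const C).map (φ ≫ q) := by
    rw [Functor.map_comp, Functor.map_comp, ← Category.assoc, h, ← Category.assoc, hφ,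
      Category.assoc]
  obtain ⟨k, b, hk⟩ := exists_map_comp_eq h'
  exact ⟨⟨k, j, X.diagram.map b ≫ φ, by simp [hφ]⟩, X.diagram.map b ≫ p, q,
    by simpa using hk, by simp, rfl⟩

section Criterion

variable [HasFiniteLimits C] {X Y : Pro C} {f : X ⟶ Y}

/-- Replacing a pro-morphism `f` by the level morphism given by a small family of arrows of `C`
under `f` which is weakly initial among all arrows of `C` under `f`. -/
theorem nonempty_iso_levelMap {K : Type v} (o : K → ArrowUnder f)
    (ho : ∀ x : ArrowUnder f, ∃ k, Nonempty (o k ⟶ x)) :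
    ∃ (I : Type v) (_ : SmallCategory I) (_ : IsCofiltered I) (F G : I ⥤ C)
      (α : F ⟶ G), (∀ i, ∃ k, Arrow.mk (α.app i) = (o k).right) ∧
        Nonempty (Arrow.mk f ≅ Arrow.mk (levelMap α)) := by
  -- the full subcategory of the arrows under `f` on the given family, which is small
  let I := InducedCategory (ArrowUnder f) o
  have : IsCofiltered I :=
    IsCofiltered.of_exists_of_isCofiltered_of_fullyFaithful (inducedFunctor o) ho
  let D : I ⥤ Arrow C := inducedFunctor o ⋙ StructuredArrow.proj _ _
  let F : I ⥤ C := D ⋙ Arrow.leftFunc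
  let G : I ⥤ C := D ⋙ Arrow.rightFunc
  let α : F ⟶ G := Functor.whiskerLeft D Arrow.leftToRight
  let u : X ⟶ Pro.mk I F :=
    lift (X := Pro.mk I F) (fun k => (o k).homLeft) (fun t => ArrowUnder.homLeft_map t.hom)
  let s : Y ⟶ Pro.mk I G :=
    lift (X := Pro.mk I G) (fun k => (o k).homRight) (fun t => ArrowUnder.homRight_map t.hom)
  have hu (k : I) : u ≫ (Pro.mk I F).proj k = (o k).homLeft := lift_proj _ _ _
  have hs (k : I) : s ≫ (Pro.mk I G).proj k = (o k).homRight := lift_proj _ _ _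
  have hus : u ≫ levelMap α = f ≫ s := by
    refine hom_ext fun k => ?_
    rw [Category.assoc, levelMap_proj, ← Category.assoc, hu, Category.assoc, hs]
    exact (o k).w
  -- parallel morphisms from a member of the family are equalized by a member of the family
  have key {k : I} {x : ArrowUnder f} (t t' : o k ⟶ x) :
      ∃ (l : I) (b : l ⟶ k), b.hom ≫ t = b.hom ≫ t' := by
    obtain ⟨l, ⟨b⟩⟩ := ho (IsCofiltered.eq t t')
    refine ⟨l, InducedCategory.homMk (b ≫ IsCofiltered.eqHom t t'), ?_⟩
    exact (Category.assoc _ _ _).trans ((congrArg (b ≫ ·) (IsCofiltered.eq_condition t t')).trans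
      (Category.assoc _ _ _).symm)
  have hT := terminalIsTerminal.isTerminalObj (const C) _
  have hu_iso : IsIso u := by
    refine isIso_of_bijective u fun A => ⟨fun p p' hpp' => ?_, fun p => ?_⟩
    · obtain ⟨k, φ, ψ, rfl, rfl⟩ := exists_proj_map₂ p p'
      have h : (o k).homLeft ≫ (const C).map ψ = (o k).homLeft ≫ (const C).map φ :=
        (congrArg (· ≫ (const C).map ψ) (hu k)).symm.trans <|
          (Category.assoc _ _ _).trans <| hpp'.symm.trans <| (Category.assoc _ _ _).symm.trans <|
            congrArg (· ≫ (const C).map φ) (hu k)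
      let x : ArrowUnder f := ArrowUnder.mk (terminal.from A) ((o k).homLeft ≫ (const C).map φ)
        (hT.from Y) (hT.hom_ext _ _)
      obtain ⟨l, b, hb⟩ := key (x := x)
        (ArrowUnder.homMk φ (terminal.from _) (terminalIsTerminal.hom_ext _ _) rfl (hT.hom_ext _ _))
        (ArrowUnder.homMk ψ (terminal.from _) (terminalIsTerminal.hom_ext _ _) h (hT.hom_ext _ _))
      have hb' : (Pro.mk I F).diagram.map b ≫ φ = (Pro.mk I F).diagram.map b ≫ ψ :=
        congrArg (fun z => z.right.left) hb
      exact (proj_map_eq_iff _ _).2 ⟨l, b, b, hb'⟩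
    · -- a morphism `p : X ⟶ A` is the same as a square from `f` to the arrow `A ⟶ ⊤_ C`
      obtain ⟨k, ⟨t⟩⟩ := ho (ArrowUnder.mk (terminal.from A) p (hT.from Y) (hT.hom_ext _ _))
      refine ⟨(Pro.mk I F).proj k ≫ (const C).map t.right.left, ?_⟩
      dsimp only
      rw [← Category.assoc, hu]
      exact ArrowUnder.homLeft_map t
  have hs_iso : IsIso s := by
    refine isIso_of_bijective s fun B => ⟨fun p p' hpp' => ?_, fun p => ?_⟩
    · obtain ⟨k, φ, ψ, rfl, rfl⟩ := exists_proj_map₂ p p'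
      have h : (o k).homRight ≫ (const C).map ψ = (o k).homRight ≫ (const C).map φ :=
        (congrArg (· ≫ (const C).map ψ) (hs k)).symm.trans <|
          (Category.assoc _ _ _).trans <| hpp'.symm.trans <| (Category.assoc _ _ _).symm.trans <|
            congrArg (· ≫ (const C).map φ) (hs k)
      let x : ArrowUnder f := ArrowUnder.mk (𝟙 B) (f ≫ (o k).homRight ≫ (const C).map φ)
        ((o k).homRight ≫ (const C).map φ) (by simp)
      have hw (χ : (o k).right.right ⟶ B) : (o k).homLeft ≫ (const C).map ((o k).right.hom ≫ χ) =
          f ≫ (o k).homRight ≫ (const C).map χ := by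
        rw [Functor.map_comp, ← Category.assoc, (o k).w, Category.assoc]
      obtain ⟨l, b, hb⟩ := key (x := x)
        (ArrowUnder.homMk ((o k).right.hom ≫ φ) φ (Category.comp_id _) (hw φ) rfl)
        (ArrowUnder.homMk ((o k).right.hom ≫ ψ) ψ (Category.comp_id _)
          ((hw ψ).trans (congrArg (f ≫ ·) h)) h)
      have hb' : (Pro.mk I G).diagram.map b ≫ φ = (Pro.mk I G).diagram.map b ≫ ψ :=
        congrArg (fun z => z.right.right) hb
      exact (proj_map_eq_iff _ _).2 ⟨l, b, b, hb'⟩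
    · -- a morphism `p : Y ⟶ B` is the same as a square from `f` to the arrow `𝟙 B`
      obtain ⟨k, ⟨t⟩⟩ := ho (ArrowUnder.mk (𝟙 B) (f ≫ p) p (by simp))
      refine ⟨(Pro.mk I G).proj k ≫ (const C).map t.right.right, ?_⟩
      dsimp only
      rw [← Category.assoc, hs]
      exact ArrowUnder.homRight_map t
  exact ⟨I, inferInstance, inferInstance, F, G, α, fun k => ⟨k, rfl⟩,
    ⟨Arrow.isoMk (asIso u) (asIso s) hus⟩⟩

/-- A pro-morphism is essentially levelwise in `W` if and only if all morphisms from it to an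
arrow of `C` factor through an arrow of `C` belonging to `W`. -/
theorem essentiallyLevelwise_iff {W : MorphismProperty C} :
    essentiallyLevelwise W f ↔ FactorsThrough W f := by
  refine ⟨factorsThrough_of_essentiallyLevelwise, fun hf => ?_⟩
  -- the squares to the terms of `f` are weakly initial, hence so are their factorizations
  have h (x : TermSquare f) := hf x.hom (X.proj x.i) (Y.proj x.j) x.w
  choose A B w u s p q hw h₁ h₂ h₃ h₄ using h
  let o (x : TermSquare f) : ArrowUnder f := ArrowUnder.mk (w x) (u x) (s x) (h₁ x)
  obtain ⟨I, _, _, F, G, α, hα, he⟩ := nonempty_iso_levelMap o (by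
    intro y
    obtain ⟨x, p', q', h', hp', hq'⟩ := TermSquare.exists_fac y.w
    have e₁ : (p x ≫ p') ≫ y.right.hom = w x ≫ q x ≫ q' := by
      rw [Category.assoc, h', ← Category.assoc, h₂, Category.assoc]
    have e₂ : u x ≫ (const C).map (p x ≫ p') = y.homLeft := by
      rw [Functor.map_comp, ← Category.assoc, h₃, hp']
    have e₃ : s x ≫ (const C).map (q x ≫ q') = y.homRight := by
      rw [Functor.map_comp, ← Category.assoc, h₄, hq']
    exact ⟨x, ⟨ArrowUnder.homMk (p x ≫ p') (q x ≫ q') e₁ e₂ e₃⟩⟩)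
  refine ⟨I, _, _, F, G, α, fun i => ?_, he⟩
  obtain ⟨x, hx⟩ := hα i
  have : W (Arrow.mk (α.app i)).hom := hx ▸ hw x
  exact this

end Criterion

/-! ### Closure properties of essentially levelwise classes -/

theorem exists_lift_const_pullback {T : Pro C} {A B D : C} {f : A ⟶ D} {g : B ⟶ D} [HasPullbacks C]
    (u : T ⟶ (const C).obj A) (s : T ⟶ (const C).obj B)
    (h : u ≫ (const C).map f = s ≫ (const C).map g) :
    ∃ t : T ⟶ (const C).obj (pullback f g),
      t ≫ (const C).map (pullback.fst f g) = u ∧ t ≫ (const C).map (pullback.snd f g) = s := by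
  obtain ⟨t, h₁, h₂⟩ := ((IsPullback.of_hasPullback f g).map (const C)).exists_lift u s h
  exact ⟨t, h₁, h₂⟩

theorem const_pullback_hom_ext {T : Pro C} {A B D : C} {f : A ⟶ D} {g : B ⟶ D} [HasPullbacks C]
    {t t' : T ⟶ (const C).obj (pullback f g)}
    (h₁ : t ≫ (const C).map (pullback.fst f g) = t' ≫ (const C).map (pullback.fst f g))
    (h₂ : t ≫ (const C).map (pullback.snd f g) = t' ≫ (const C).map (pullback.snd f g)) :
    t = t' :=
  ((IsPullback.of_hasPullback f g).map (const C)).hom_ext h₁ h₂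

theorem FactorsThrough.mono {W W' : MorphismProperty C} (h : W ≤ W') :
    FactorsThrough W ≤ FactorsThrough W' := by
  intro X Y f hf A B a u s hus
  obtain ⟨A', B', w, u', s', p, q, hw, H⟩ := hf a u s hus
  exact ⟨A', B', w, u', s', p, q, h _ hw, H⟩

theorem factorsThrough_id {W : MorphismProperty C} [W.ContainsIdentities] (X : Pro C) :
    FactorsThrough W (𝟙 X) := by
  intro A B a u s hus
  rw [Category.id_comp] at hus
  exact ⟨A, A, 𝟙 A, u, u, 𝟙 A, a, W.id_mem A, by simp, by simp, by simp, hus⟩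

theorem FactorsThrough.comp [HasPullbacks C] {W : MorphismProperty C} [W.IsStableUnderComposition]
    [W.IsStableUnderBaseChange] {X Y Z : Pro C} {f : X ⟶ Y} {g : Y ⟶ Z}
    (hf : FactorsThrough W f) (hg : FactorsThrough W g) : FactorsThrough W (f ≫ g) := by
  intro A B a u s hus
  obtain ⟨A₁, B₁, w₁, u₁, s₁, p₁, q₁, hw₁, h₁, h₂, h₃, h₄⟩ :=
    hf a u (g ≫ s) (by rw [hus, Category.assoc])
  obtain ⟨A₂, B₂, w₂, u₂, s₂, p₂, q₂, hw₂, k₁, k₂, k₃, k₄⟩ := hg q₁ s₁ s h₄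
  obtain ⟨t, ht₁, ht₂⟩ := exists_lift_const_pullback (f := w₁) (g := p₂) u₁ (f ≫ u₂)
    (by rw [h₁, Category.assoc, k₃])
  refine ⟨pullback w₁ p₂, B₂, pullback.snd w₁ p₂ ≫ w₂, t, s₂, pullback.fst w₁ p₂ ≫ p₁, q₂,
    W.comp_mem _ _ (W.pullback_snd _ _ hw₁) hw₂, ?_, ?_, ?_, k₄⟩
  · rw [Functor.map_comp, ← Category.assoc, ht₂, Category.assoc, k₁, Category.assoc]
  · rw [Category.assoc, h₂, pullback.condition_assoc, k₂, Category.assoc]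
  · rw [Functor.map_comp, ← Category.assoc, ht₁, h₃]

/-- If `Z` is a cofiltered limit of the `F_j`, a compatible family of morphisms `F_j ⟶ Y` with
the factorization property induces a morphism `Z ⟶ Y` with the same property. -/
theorem factorsThrough_of_isLimit {W : MorphismProperty C} {J : Type*} [Category J]
    [EssentiallySmall.{v} J] [IsCofiltered J] {F : J ⥤ Pro C} {c : Cone F} (hc : IsLimit c)
    {Y : Pro C} (τ : F ⟶ (Functor.const J).obj Y) (hτ : ∀ j, FactorsThrough W (τ.app j))
    {f : c.pt ⟶ Y} (hf : ∀ j, c.π.app j ≫ τ.app j = f) : FactorsThrough W f := by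
  intro A B a u s hus
  obtain ⟨j, t, rfl⟩ := exists_fac_of_isLimit hc u
  obtain ⟨k, b, hb⟩ := exists_map_comp_eq_of_isLimit hc (s := t ≫ (const C).map a)
    (t := τ.app j ≫ s) (by rw [← Category.assoc, hus, ← hf j, Category.assoc])
  obtain ⟨A', B', w, u', s', p, q, hw, h₁, h₂, h₃, h₄⟩ := hτ k a (F.map b ≫ t) s (by
    have := τ.naturality b
    rw [Category.assoc, hb, ← Category.assoc, this]
    simp)
  refine ⟨A', B', w, c.π.app k ≫ u', s', p, q, hw, ?_, h₂, ?_, h₄⟩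
  · rw [Category.assoc, h₁, ← Category.assoc, hf]
  · rw [Category.assoc, h₃, ← Category.assoc, c.w]

/-- The restriction of a pro-object to the stages before a given stage. -/
abbrev restrictOver (Y : Pro C) (i : Y.Index) : Pro C :=
  Pro.mk (Over i) (Over.forget i ⋙ Y.diagram)

/-- The comparison of a pro-object with its restriction to the stages before a given stage. -/
def toOver (Y : Pro C) (i : Y.Index) : Y ⟶ Y.restrictOver i :=
  lift (X := Y.restrictOver i) (fun o => Y.proj o.left) (fun t => Y.proj_map t.left)

@[simp]
theorem toOver_proj (Y : Pro C) (i : Y.Index) (o : Over i) :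
    Y.toOver i ≫ (Y.restrictOver i).proj o = Y.proj o.left :=
  lift_proj (X := Y.restrictOver i) (fun o : Over i => Y.proj o.left)
    (fun t => Y.proj_map t.left) o

instance (Y : Pro C) (i : Y.Index) : IsIso (Y.toOver i) := by
  refine isIso_of_bijective _ fun A => ⟨fun p p' hpp' => ?_, fun p => ?_⟩
  · obtain ⟨o, φ, ψ, rfl, rfl⟩ := exists_proj_map₂ p p'
    have h : Y.proj o.left ≫ (const C).map φ = Y.proj o.left ≫ (const C).map ψ := by
      rw [← toOver_proj]
      exact (Category.assoc _ _ _).trans (hpp'.trans (Category.assoc _ _ _).symm)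
    obtain ⟨k, a, ha⟩ := exists_map_comp_eq h
    exact (proj_map_eq_iff _ _).2
      ⟨Over.mk (a ≫ o.hom), Over.homMk a, Over.homMk a, ha⟩
  · obtain ⟨j, φ, rfl⟩ := exists_proj_map p
    refine ⟨(Y.restrictOver i).proj (Over.mk (IsCofiltered.minToLeft i j)) ≫
      (const C).map (Y.diagram.map (IsCofiltered.minToRight i j) ≫ φ), ?_⟩
    dsimp only
    rw [← Category.assoc, toOver_proj, Functor.map_comp]
    exact proj_map_assoc _ _ _

/-- The morphism to a constant pro-object given by a compatible family of morphisms from all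
stages. -/
noncomputable def toConst {I : Type v} [SmallCategory I] [IsCofiltered I] {F : I ⥤ C} {A : C}
    (β : F ⟶ (Functor.const I).obj A) : Pro.mk I F ⟶ (const C).obj A :=
  (Pro.mk I F).proj (IsCofiltered.nonempty (C := I)).some ≫ (const C).map (β.app _)

theorem toConst_eq {I : Type v} [SmallCategory I] [IsCofiltered I] {F : I ⥤ C} {A : C}
    (β : F ⟶ (Functor.const I).obj A) (i : I) :
    toConst β = (Pro.mk I F).proj i ≫ (const C).map (β.app i) := by
  let i₀ := (IsCofiltered.nonempty (C := I)).some
  refine (proj_map_eq_iff (X := Pro.mk I F) (β.app i₀) (β.app i)).2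
    ⟨IsCofiltered.min i₀ i, IsCofiltered.minToLeft i₀ i, IsCofiltered.minToRight i₀ i, ?_⟩
  exact (β.naturality _).trans (β.naturality (IsCofiltered.minToRight i₀ i)).symm

/-- A levelwise pullback of a constant morphism is a pullback in `pro-C`. -/
theorem isPullback_levelMap {I : Type v} [SmallCategory I] [IsCofiltered I] {R H : I ⥤ C}
    {A B : C} {β : R ⟶ (Functor.const I).obj A} {ρ : R ⟶ H} {w : A ⟶ B}
    {α : H ⟶ (Functor.const I).obj B}
    (h : ∀ i, IsPullback (β.app i) (ρ.app i) w (α.app i)) :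
    IsPullback (toConst β) (levelMap ρ) ((const C).map w) (toConst α) := by
  have h' (i : I) := (h i).map (const C)
  have comm : toConst β ≫ (const C).map w = levelMap ρ ≫ toConst α := by
    let i := (IsCofiltered.nonempty (C := I)).some
    rw [toConst_eq β i, toConst_eq α i, levelMap_proj_assoc, Category.assoc]
    exact congrArg _ (h' i).w
  have ex {T : Pro C} (x : T ⟶ (const C).obj A) (y : T ⟶ Pro.mk I H)
      (hxy : x ≫ (const C).map w = y ≫ toConst α) :
      ∃ t : T ⟶ Pro.mk I R, t ≫ toConst β = x ∧ t ≫ levelMap ρ = y := by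
    have ex' (i : I) := (h' i).exists_lift x (y ≫ (Pro.mk I H).proj i) (by
      rw [hxy, toConst_eq α i, Category.assoc])
    choose t ht₁ ht₂ using ex'
    have ht {i j : I} (a : i ⟶ j) : t i ≫ (const C).map (R.map a) = t j := by
      refine (h' j).hom_ext ?_ ?_
      · rw [ht₁, Category.assoc, ← Functor.map_comp, ← ht₁ i]
        exact congrArg (fun z => t i ≫ (const C).map z)
          ((β.naturality a).trans (Category.comp_id _))
      · rw [ht₂, Category.assoc, ← Functor.map_comp, ρ.naturality, Functor.map_comp,
          ← Category.assoc, ht₂, Category.assoc]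
        exact congrArg _ ((Pro.mk I H).proj_map a)
    have hl (i : I) : lift (X := Pro.mk I R) t ht ≫ (Pro.mk I R).proj i = t i := lift_proj _ _ _
    refine ⟨lift (X := Pro.mk I R) t ht, ?_, hom_ext fun (i : I) => ?_⟩
    · rw [toConst_eq β (IsCofiltered.nonempty (C := I)).some, ← Category.assoc, hl]
      exact ht₁ _
    · rw [Category.assoc, levelMap_proj, ← Category.assoc, hl]
      exact ht₂ i
  have uniq {T : Pro C} {t t' : T ⟶ Pro.mk I R} (h₁ : t ≫ toConst β = t' ≫ toConst β)
      (h₂ : t ≫ levelMap ρ = t' ≫ levelMap ρ) : t = t' := by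
    refine hom_ext fun (i : I) => (h' i).hom_ext ?_ ?_
    · rw [toConst_eq β i] at h₁
      exact (Category.assoc _ _ _).trans (h₁.trans (Category.assoc _ _ _).symm)
    · have := congrArg (· ≫ (Pro.mk I H).proj i) h₂
      simp only [Category.assoc, levelMap_proj] at this
      exact (Category.assoc _ _ _).trans (this.trans (Category.assoc _ _ _).symm)
  refine ⟨⟨comm⟩, ⟨PullbackCone.IsLimit.mk comm (fun s => (ex s.fst s.snd s.condition).choose)
    (fun s => (ex s.fst s.snd s.condition).choose_spec.1)
    (fun s => (ex s.fst s.snd s.condition).choose_spec.2) (fun s m h₁ h₂ => uniq ?_ ?_)⟩⟩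
  · rw [h₁, (ex s.fst s.snd s.condition).choose_spec.1]
  · rw [h₂, (ex s.fst s.snd s.condition).choose_spec.2]

/-- Base changes of constant morphisms are essentially levelwise: the pullback is formed on all
stages before one at which the morphism `h` is defined. -/
theorem factorsThrough_of_isPullback_const [HasPullbacks C] {W : MorphismProperty C}
    [W.IsStableUnderBaseChange] {A B : C} {w : A ⟶ B} (hw : W w) {P Y : Pro C}
    {g : P ⟶ (const C).obj A} {q : P ⟶ Y} {h : Y ⟶ (const C).obj B}
    (sq : IsPullback g q ((const C).map w) h) : FactorsThrough W q := by
  obtain ⟨i, φ, rfl⟩ := exists_proj_map h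
  let H : Over i ⥤ C := Over.forget i ⋙ Y.diagram
  let α : H ⟶ (Functor.const _).obj B :=
    { app o := Y.diagram.map o.hom ≫ φ
      naturality o o' a := by
        simp [H, ← Functor.map_comp_assoc] }
  let β : (Functor.const (Over i)).obj A ⟶ (Functor.const _).obj B := (Functor.const _).map w
  have hR (o : Over i) : IsPullback ((pullback.fst β α).app o) ((pullback.snd β α).app o)
      w (α.app o) :=
    (IsPullback.of_hasPullback β α).map ((evaluation _ _).obj o)
  have hα : Y.toOver i ≫ toConst α = Y.proj i ≫ (const C).map φ := by
    rw [toConst_eq α (Over.mk (𝟙 i)), ← Category.assoc, toOver_proj]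
    exact congrArg (fun z => Y.proj i ≫ (const C).map z)
      ((congrArg (· ≫ φ) (Y.diagram.map_id i)).trans (Category.id_comp φ))
  have sq' : IsPullback g (q ≫ Y.toOver i) ((const C).map w) (toConst α) :=
    sq.of_iso (Iso.refl _) (Iso.refl _) (asIso (Y.toOver i)) (Iso.refl _) (by simp) (by simp)
      (by simp) (by simp [hα])
  have e : Arrow.mk q ≅ Arrow.mk (levelMap (pullback.snd β α)) :=
    Arrow.isoMk (sq'.isoIsPullback _ _ (isPullback_levelMap hR))
      (show Y ≅ Pro.mk (Over i) H from asIso (Y.toOver i))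
      (sq'.isoIsPullback_hom_snd _ _ _)
  exact ((FactorsThrough W).arrow_mk_iso_iff e).2
    (factorsThrough_levelMap _ fun o => W.of_isPullback (hR o) hw)

/-! ### Base changes of products of constant morphisms -/

section FiniteProducts

variable [HasFiniteProducts C] {α : Type v}

/-- The products of a family of objects over the finite subsets of its index type. -/
noncomputable def finProd (V : α → C) : (Finset α)ᵒᵖ ⥤ C where
  obj S := ∏ᶜ fun l : S.unop => V l
  map {S T} a := Pi.lift fun l : T.unop =>
    Pi.π (fun l : S.unop => V l) ⟨l.1, leOfHom a.unop l.2⟩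

/-- The projections of a finite product. -/
noncomputable def finProd.π (V : α → C) (S : (Finset α)ᵒᵖ) (l : S.unop) :
    (finProd V).obj S ⟶ V l :=
  Pi.π (fun l : S.unop => V l) l

theorem finProd.map_π (V : α → C) {S T : (Finset α)ᵒᵖ} (a : S ⟶ T) (l : T.unop) :
    (finProd V).map a ≫ finProd.π V T l = finProd.π V S ⟨l.1, leOfHom a.unop l.2⟩ :=
  Pi.lift_π _ _

/-- The morphism between finite products induced by a family of morphisms. -/
noncomputable def finProdMap {V W : α → C} (w : ∀ l, W l ⟶ V l) : finProd W ⟶ finProd V where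
  app S := show (∏ᶜ fun l : S.unop => W l) ⟶ ∏ᶜ fun l : S.unop => V l from
    Limits.Pi.map fun l : S.unop => w l
  naturality S T a := by
    dsimp [finProd]
    ext l
    simp

theorem finProdMap_π {V W : α → C} (w : ∀ l, W l ⟶ V l) (S : (Finset α)ᵒᵖ) (l : S.unop) :
    (finProdMap w).app S ≫ finProd.π V S l = finProd.π W S l ≫ w l :=
  Limits.Pi.map_π (fun l : S.unop => w l) l

/-- The constant pro-object on a finite product is a product of constant pro-objects. -/
theorem exists_lift_const_finProd {V : α → C} (S : (Finset α)ᵒᵖ) {T : Pro C}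
    (y : ∀ l, T ⟶ (const C).obj (V l)) :
    ∃ t : T ⟶ (const C).obj ((finProd V).obj S),
      ∀ l : S.unop, t ≫ (const C).map (finProd.π V S l) = y l := by
  have h := isLimitOfHasProductOfPreservesLimit (const C) (fun l : S.unop => V l)
  exact ⟨Fan.IsLimit.lift h fun l => y l, fun l => Fan.IsLimit.fac h _ l⟩

theorem const_finProd_hom_ext {V : α → C} {S : (Finset α)ᵒᵖ} {T : Pro C}
    {t t' : T ⟶ (const C).obj ((finProd V).obj S)}
    (h : ∀ l : S.unop, t ≫ (const C).map (finProd.π V S l) =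
      t' ≫ (const C).map (finProd.π V S l)) : t = t' :=
  Fan.IsLimit.hom_ext (isLimitOfHasProductOfPreservesLimit (const C) (fun l : S.unop => V l)) _ _ h

theorem exists_natTrans_finProd {V : α → C} {Z : Pro C} (z : ∀ l, Z ⟶ (const C).obj (V l)) :
    ∃ ζ : (Functor.const (Finset α)ᵒᵖ).obj Z ⟶ finProd V ⋙ const C, ∀ S (l : S.unop),
      (show Z ⟶ (const C).obj ((finProd V).obj S) from ζ.app S) ≫
        (const C).map (finProd.π V S l) = z l := by
  choose t ht using fun S : (Finset α)ᵒᵖ => exists_lift_const_finProd S z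
  refine ⟨{ app := t, naturality := fun S T a => ?_ }, ht⟩
  refine (Category.id_comp (t T)).trans ?_
  refine const_finProd_hom_ext fun l => ?_
  rw [ht, Functor.comp_map, Category.assoc, ← Functor.map_comp, finProd.map_π, ht]

end FiniteProducts

/-- Given a family of morphisms `w l : W l ⟶ V l` of `C` and a family of morphisms `Z ⟶ V l`, the
pullback of the product of the `w l` to `Z`, expressed by its universal property. It is
essentially levelwise because it is the cofiltered limit, over the finite subfamilies, of base
changes of morphisms of `C`. -/
theorem exists_pullback_product [HasLimits C] {L : MorphismProperty C} {α : Type v} {V W : α → C}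
    (w : ∀ l, W l ⟶ V l) (hw : ∀ l, L.rlp (w l)) {Z : Pro C} (z : ∀ l, Z ⟶ (const C).obj (V l)) :
    ∃ (Z' : Pro C) (q : Z' ⟶ Z) (z' : ∀ l, Z' ⟶ (const C).obj (W l)), FactorsThrough L.rlp q ∧
      (∀ l, z' l ≫ (const C).map (w l) = q ≫ z l) ∧
      (∀ {T : Pro C} (x : T ⟶ Z) (y : ∀ l, T ⟶ (const C).obj (W l)),
        (∀ l, y l ≫ (const C).map (w l) = x ≫ z l) →
          ∃ t : T ⟶ Z', t ≫ q = x ∧ ∀ l, t ≫ z' l = y l) ∧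
      (∀ {T : Pro C} (t t' : T ⟶ Z'), t ≫ q = t' ≫ q → (∀ l, t ≫ z' l = t' ≫ z' l) →
        t = t') := by
  have : HasLimits (Pro C) := hasLimits
  obtain ⟨ζ, hζ⟩ := exists_natTrans_finProd z
  let ω : finProd W ⋙ const C ⟶ finProd V ⋙ const C :=
    Functor.whiskerRight (finProdMap w) (const C)
  let P := pullback ω ζ
  let π (S : (Finset α)ᵒᵖ) : P.obj S ⟶ (const C).obj ((finProd W).obj S) :=
    (pullback.fst ω ζ).app S
  let τ : P ⟶ (Functor.const _).obj Z := pullback.snd ω ζ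
  let σ (S : (Finset α)ᵒᵖ) : P.obj S ⟶ Z := τ.app S
  have hP (S) : IsPullback (π S) (σ S) ((const C).map ((finProdMap w).app S)) (ζ.app S) :=
    (IsPullback.of_hasPullback ω ζ).map ((evaluation _ _).obj S)
  have hσ {S T} (a : S ⟶ T) : P.map a ≫ σ T = σ S := (τ.naturality a).trans (Category.comp_id _)
  have hπ {S T} (a : S ⟶ T) : P.map a ≫ π T = π S ≫ (const C).map ((finProd W).map a) :=
    (pullback.fst ω ζ).naturality a
  let q : limit P ⟶ Z := limit.π P (op ∅) ≫ σ (op ∅)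
  have hq (S) : limit.π P S ≫ σ S = q := by
    let a : S ⟶ op ∅ := (homOfLE (Finset.empty_subset _)).op
    rw [← hσ a, limit.w_assoc]
  let z' (l : α) : limit P ⟶ (const C).obj (W l) :=
    limit.π P (op {l}) ≫ π (op {l}) ≫
      (const C).map (finProd.π W (op {l}) ⟨l, Finset.mem_singleton_self l⟩)
  have hz' (S : (Finset α)ᵒᵖ) (l : S.unop) :
      limit.π P S ≫ π S ≫ (const C).map (finProd.π W S l) = z' l := by
    let a : S ⟶ op {l.1} := (homOfLE (Finset.singleton_subset_iff.2 l.2)).op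
    have h : finProd.π W S l = (finProd W).map a ≫
      finProd.π W (op {l.1}) ⟨l.1, Finset.mem_singleton_self l.1⟩ :=
      (finProd.map_π W a ⟨l.1, Finset.mem_singleton_self l.1⟩).symm
    have h' := hπ a
    dsimp only [z']
    rw [← limit.w P a, h, Functor.map_comp, Category.assoc, reassoc_of% h']
  have comm (S : (Finset α)ᵒᵖ) (l : S.unop) :
      (π S ≫ (const C).map (finProd.π W S l)) ≫ (const C).map (w l) = σ S ≫ z l := by
    have h₁ := (hP S).w
    have h₂ := hζ S l
    rw [Category.assoc, ← Functor.map_comp, ← finProdMap_π, Functor.map_comp, reassoc_of% h₁]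
    exact congrArg (σ S ≫ ·) h₂
  refine ⟨limit P, q, z', ?_, fun l => ?_, fun {T} x y hxy => ?_, fun {T} t t' h₁ h₂ => ?_⟩
  · refine factorsThrough_of_isLimit (limit.isLimit P) τ (fun S => ?_) hq
    have : L.rlp ((finProdMap w).app S) := by
      intro A B i hi
      have := fun l : S.unop => hw l i hi
      exact inferInstanceAs (HasLiftingProperty i (Limits.Pi.map fun l : S.unop => w l))
    exact factorsThrough_of_isPullback_const this (hP S)
  · have := comm (op {l}) ⟨l, Finset.mem_singleton_self l⟩
    dsimp only [z', q]
    rw [Category.assoc, this, ← Category.assoc, hq]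
  · choose y' hy' using fun S : (Finset α)ᵒᵖ => exists_lift_const_finProd S y
    have ex (S : (Finset α)ᵒᵖ) := (hP S).exists_lift (y' S) x (by
      refine const_finProd_hom_ext fun l => ?_
      have := hy' S l
      have h₂ := hζ S l
      rw [Category.assoc, ← Functor.map_comp, finProdMap_π, Functor.map_comp, reassoc_of% this,
        hxy]
      exact (congrArg (x ≫ ·) h₂).symm.trans (Category.assoc _ _ _).symm)
    choose t ht₁ ht₂ using ex
    have ht {S T} (a : S ⟶ T) : t S ≫ P.map a = t T := by
      refine (hP T).hom_ext ?_ ?_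
      · refine const_finProd_hom_ext fun l => ?_
        rw [Category.assoc (t S), hπ, ← Category.assoc (t S), ht₁, Category.assoc,
          ← Functor.map_comp, finProd.map_π, hy', ht₁, hy']
      · rw [Category.assoc, hσ, ht₂, ht₂]
    refine ⟨limit.lift P ⟨T, { app := t, naturality := fun S T a =>
      (Category.id_comp _).trans (ht a).symm }⟩, ?_, fun l => ?_⟩
    · dsimp only [q]
      rw [limit.lift_π_assoc]
      exact ht₂ _
    · dsimp only [z']
      rw [limit.lift_π_assoc]
      exact (Category.assoc _ _ _).symm.trans ((congrArg (· ≫ _) (ht₁ _)).trans (hy' _ _))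
  · refine limit.hom_ext fun S => (hP S).hom_ext ?_ ?_
    · refine const_finProd_hom_ext fun l => ?_
      rw [Category.assoc, Category.assoc, Category.assoc, Category.assoc, hz', h₂]
    · rw [Category.assoc, Category.assoc, hq, h₁]

/-! ### Factorizations -/

theorem llp_strictMap_const_iff {R : MorphismProperty C} {X Y : Pro C} (f : X ⟶ Y) :
    (R.strictMap (const C)).llp f ↔
      ∀ ⦃A B : C⦄ (p : A ⟶ B), R p → ∀ (u : X ⟶ (const C).obj A) (s : Y ⟶ (const C).obj B),
        u ≫ (const C).map p = f ≫ s →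
          ∃ t : Y ⟶ (const C).obj A, f ≫ t = u ∧ t ≫ (const C).map p = s := by
  constructor
  · intro hf A B p hp u s h
    have := hf _ (MorphismProperty.strictMap.map (F := const C) hp)
    have sq : CommSq u f ((const C).map p) s := ⟨h⟩
    exact ⟨sq.lift, sq.fac_left, sq.fac_right⟩
  · rintro hf _ _ _ ⟨hp⟩
    refine ⟨fun {u s} sq => ?_⟩
    obtain ⟨t, h₁, h₂⟩ := hf _ hp u s sq.w
    exact ⟨⟨⟨t, h₁, h₂⟩⟩⟩

/-- One step of the small object argument: a factorization of `g` such that the lifting problems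
against constant morphisms in `L.rlp` that `g` poses are solved after base change to `Z'`. -/
theorem exists_step [HasLimits C] (L : MorphismProperty C) [L.HasFactorization L.rlp]
    {X Z : Pro C} (g : X ⟶ Z) :
    ∃ (Z' : Pro C) (q : Z' ⟶ Z) (g' : X ⟶ Z'), g' ≫ q = g ∧ FactorsThrough L.rlp q ∧
      (L.rlp.strictMap (const C)).llp.rlp q ∧
      ∀ ⦃A B : C⦄ (p : A ⟶ B), L.rlp p → ∀ (u : X ⟶ (const C).obj A) (s : Z ⟶ (const C).obj B),
        u ≫ (const C).map p = g ≫ s →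
          ∃ t : Z' ⟶ (const C).obj A, g' ≫ t = u ∧ t ≫ (const C).map p = q ≫ s := by
  let d (x : TermSquare g) := MorphismProperty.factorizationData L L.rlp x.hom
  obtain ⟨Z', q, z', hq, hz', hlift, hext⟩ := exists_pullback_product (fun x => (d x).p)
    (fun x => (d x).hp) (fun x : TermSquare g => Z.proj x.j)
  obtain ⟨g', hg', hg'z⟩ := hlift g (fun x => X.proj x.i ≫ (const C).map (d x).i) (by
    intro x
    rw [Category.assoc, ← Functor.map_comp, (d x).fac, x.w])
  refine ⟨Z', q, g', hg', hq, ?_, ?_⟩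
  · intro S T i hi
    refine ⟨fun {a b} sq => ?_⟩
    rw [llp_strictMap_const_iff] at hi
    choose y hy₁ hy₂ using fun x => hi (d x).p (d x).hp (a ≫ z' x) (b ≫ Z.proj x.j) (by
      rw [Category.assoc, hz', ← Category.assoc, sq.w, Category.assoc])
    obtain ⟨t, ht₁, ht₂⟩ := hlift b y hy₂
    refine ⟨⟨⟨t, hext _ _ ?_ fun x => ?_, ht₁⟩⟩⟩
    · rw [Category.assoc, ht₁, sq.w]
    · rw [Category.assoc, ht₂, hy₁]
  · intro A B p hp u s hus
    obtain ⟨x, a, b, hab, rfl, rfl⟩ := TermSquare.exists_fac hus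
    have := hp _ (d x).hi
    have sq : CommSq a (d x).i p ((d x).p ≫ b) := ⟨by rw [(d x).fac_assoc, hab]⟩
    refine ⟨z' x ≫ (const C).map sq.lift, ?_, ?_⟩
    · rw [← Category.assoc, hg'z, Category.assoc, ← Functor.map_comp, sq.fac_left]
    · rw [Category.assoc, ← Functor.map_comp, sq.fac_right, Functor.map_comp, ← Category.assoc,
        hz', Category.assoc]

/-- A class of morphisms defined by a right lifting property is closed under limits of towers. -/
theorem rlp_of_tower {F : ℕᵒᵖ ⥤ Pro C} {c : Cone F} (hc : IsLimit c)
    {Q : MorphismProperty (Pro C)}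
    (h : ∀ n : ℕ, Q.rlp (F.map (homOfLE (Nat.le_succ n)).op)) : Q.rlp (c.π.app (op 0)) := by
  intro S T i hi
  refine ⟨fun {a b} sq => ?_⟩
  -- partial lifts to the stages of the tower, chosen recursively
  let E (n : ℕ) := { t : T ⟶ F.obj (op n) // i ≫ t = a ≫ c.π.app (op n) }
  have step (n : ℕ) (t : E n) :
      ∃ t' : E (n + 1), t'.1 ≫ F.map (homOfLE (Nat.le_succ n)).op = t.1 := by
    have := h n i hi
    have sq' : CommSq (a ≫ c.π.app (op (n + 1))) i (F.map (homOfLE (Nat.le_succ n)).op) t.1 :=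
      ⟨by rw [Category.assoc, c.w, t.2]⟩
    exact ⟨⟨sq'.lift, sq'.fac_left⟩, sq'.fac_right⟩
  choose next hnext using step
  let t (n : ℕ) : E n := Nat.rec ⟨b, sq.w.symm⟩ next n
  let s : Cone F := ⟨T, NatTrans.ofOpSequence (fun n => (t n).1) (fun n => by
    exact (Category.id_comp _).trans (hnext n (t n)).symm)⟩
  refine ⟨⟨⟨hc.lift s, hc.hom_ext fun n => ?_, ?_⟩⟩⟩
  · rw [Category.assoc, hc.fac]
    exact (t n.unop).2
  · exact hc.fac s (op 0)

/-- The generalized cosmall object argument: every morphism `f` of `pro-C` factors as a morphism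
with the left lifting property against constant morphisms in `L.rlp`, followed by a morphism with
the corresponding right lifting property. Since constant pro-objects are cocompact, a countable
tower suffices. -/
theorem exists_factorization [HasLimits C] (L : MorphismProperty C) [L.HasFactorization L.rlp]
    {X Y : Pro C} (f : X ⟶ Y) :
    ∃ (Z : Pro C) (i : X ⟶ Z) (p : Z ⟶ Y), i ≫ p = f ∧ (L.rlp.strictMap (const C)).llp i ∧
      (L.rlp.strictMap (const C)).llp.rlp p ∧ FactorsThrough L.rlp p := by
  have : HasLimits (Pro C) := hasLimits
  have : HasLimitsOfShape ℕᵒᵖ (Pro C) := hasLimitsOfShape_of_essentiallySmall.{v} _ _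
  choose Z' q g' hg' hq hq' hlift using fun U : Under X => exists_step L U.hom
  let U (n : ℕ) : Under X := Nat.rec (Under.mk f) (fun _ V => Under.mk (g' V)) n
  let r (n : ℕ) : U (n + 1) ⟶ U n := Under.homMk (q (U n)) (hg' (U n))
  let G : ℕᵒᵖ ⥤ Under X := Functor.ofOpSequence r
  let F : ℕᵒᵖ ⥤ Pro C := G ⋙ Under.forget X
  have hF (n : ℕ) : F.map (homOfLE (Nat.le_succ n)).op = q (U n) :=
    congrArg (Under.forget X).map (Functor.ofOpSequence_map_homOfLE_succ r n)
  let s : Cone F := ⟨X, { app n := (G.obj n).hom, naturality m n a := by simp [F] }⟩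
  let i : X ⟶ limit F := limit.lift F s
  let τ : F ⟶ (Functor.const _).obj Y :=
    { app n := F.map (homOfLE (Nat.zero_le n.unop)).op
      naturality m n a := by
        exact (F.map_comp a (homOfLE (Nat.zero_le n.unop)).op).symm.trans
          (Category.comp_id (F.map _)).symm }
  have hτ (n : ℕ) : FactorsThrough L.rlp (τ.app (op n)) := by
    induction n with
    | zero =>
      have : τ.app (op 0) = 𝟙 Y := F.map_id _
      rw [this]
      exact factorsThrough_id Y
    | succ n hn =>
      have : τ.app (op (n + 1)) = q (U n) ≫ τ.app (op n) := by
        rw [← hF]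
        exact F.map_comp (homOfLE (Nat.le_succ n)).op (homOfLE (Nat.zero_le n)).op
      rw [this]
      exact (hq (U n)).comp hn
  refine ⟨limit F, i, limit.π F (op 0), limit.lift_π s (op 0), ?_, ?_, ?_⟩
  · rw [llp_strictMap_const_iff]
    intro A B p hp u t hut
    obtain ⟨n, t, rfl⟩ := exists_fac_of_isLimit (limit.isLimit F) t
    obtain ⟨n⟩ := n
    obtain ⟨t', h₁, h₂⟩ : ∃ t' : F.obj (op (n + 1)) ⟶ (const C).obj A,
        s.π.app (op (n + 1)) ≫ t' = u ∧
          t' ≫ (const C).map p = F.map (homOfLE (Nat.le_succ n)).op ≫ t := by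
      rw [hF]
      refine hlift (U n) p hp u t ?_
      rw [hut, ← Category.assoc]
      exact congrArg (· ≫ t) (limit.lift_π s (op n))
    refine ⟨limit.π F (op (n + 1)) ≫ t', ?_, ?_⟩
    · rw [limit.lift_π_assoc, h₁]
    · rw [Category.assoc, h₂, limit.w_assoc]
      rfl
  · exact rlp_of_tower (limit.isLimit F) fun n => hF n ▸ hq' (U n)
  · exact factorsThrough_of_isLimit (limit.isLimit F) τ (fun n => hτ n.unop)
      (fun n => limit.w F _)

/-! ### Weak equivalences -/

section WeakEquivalences

variable [ModelCategory C] [IsProperModelCategory C]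

/-- A morphism from `f ≫ g` to an arrow of `C` is first factored, on the part of `f`, through a
weak equivalence `w₁`, and then, on the part of `g`, through a weak equivalence `w₂`. The latter is
pushed out, and `w₁` is pulled back, so that the two can be composed. -/
theorem factorsThrough_weakEquivalences_comp {X Y Z : Pro C} {f : X ⟶ Y} {g : Y ⟶ Z}
    (hf : FactorsThrough (weakEquivalences C) f) (hg : FactorsThrough (weakEquivalences C) g) :
    FactorsThrough (weakEquivalences C) (f ≫ g) := by
  intro A B a u s hus
  obtain ⟨A₁, B₁, w₁, u₁, s₁, p₁, q₁, hw₁, h₁, h₂, h₃, h₄⟩ :=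
    hf a u (g ≫ s) (by rw [hus, Category.assoc])
  obtain ⟨A₂, B₂, w₂, u₂, s₂, p₂, q₂, hw₂, k₁, k₂, k₃, k₄⟩ := hg q₁ s₁ s h₄
  -- right properness lets `w₁` be pulled back along the fibration part of `p₂`
  let d := MorphismProperty.factorizationData (trivialCofibrations C) (fibrations C) p₂
  have hd : weakEquivalences C d.i := d.hi.2
  have hfst : weakEquivalences C (pullback.snd w₁ d.p) :=
    IsProperModelCategory.right_proper (IsPullback.of_hasPullback w₁ d.p).flip d.hp hw₁
  have hinl : trivialCofibrations C (pushout.inl w₂ d.i) :=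
    MorphismProperty.pushout_inl _ _ d.hi
  have hinr : weakEquivalences C (pushout.inr w₂ d.i) := by
    refine (weakEquivalences C).of_precomp _ _ hd ?_
    rw [← pushout.condition]
    exact (weakEquivalences C).comp_mem _ _ hw₂ hinl.2
  obtain ⟨t, ht₁, ht₂⟩ := exists_lift_const_pullback (f := w₁) (g := d.p) u₁
    (f ≫ u₂ ≫ (const C).map d.i) (by
      rw [h₁, Category.assoc, Category.assoc, ← Functor.map_comp, d.fac, k₃])
  refine ⟨pullback w₁ d.p, pushout w₂ d.i, pullback.snd _ _ ≫ pushout.inr _ _, t,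
    s₂ ≫ (const C).map (pushout.inl _ _), pullback.fst _ _ ≫ p₁,
    pushout.desc q₂ (d.p ≫ q₁) (by rw [d.fac_assoc, k₂]),
    (weakEquivalences C).comp_mem _ _ hfst hinr, ?_, ?_, ?_, ?_⟩
  · have k₁' : u₂ ≫ (const C).map w₂ ≫ (const C).map (pushout.inl w₂ d.i) =
        g ≫ s₂ ≫ (const C).map (pushout.inl w₂ d.i) := by
      rw [← Category.assoc, k₁, Category.assoc]
    rw [Functor.map_comp, ← Category.assoc, ht₂, Category.assoc, Category.assoc, Category.assoc,
      ← k₁', ← Functor.map_comp, ← Functor.map_comp, pushout.condition]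
  · rw [Category.assoc, h₂, Category.assoc, pushout.inr_desc, pullback.condition_assoc]
  · rw [Functor.map_comp, ← Category.assoc, ht₁, h₃]
  · rw [Category.assoc, ← Functor.map_comp, pushout.inl_desc, k₄]

/-- The factorization for `f ≫ g` provides a weak equivalence `w₁` with the right target; the one
for `f` is used to replace its source by an object that receives a morphism from `Y`. -/
theorem factorsThrough_weakEquivalences_of_precomp {X Y Z : Pro C} {f : X ⟶ Y} {g : Y ⟶ Z}
    (hf : FactorsThrough (weakEquivalences C) f)
    (hfg : FactorsThrough (weakEquivalences C) (f ≫ g)) :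
    FactorsThrough (weakEquivalences C) g := by
  intro A B a u s hus
  obtain ⟨A₁, B₁, w₁, u₁, s₁, p₁, q₁, hw₁, h₁, h₂, h₃, h₄⟩ :=
    hfg a (f ≫ u) s (by rw [Category.assoc, hus, Category.assoc])
  obtain ⟨v, hv₁, hv₂⟩ := exists_lift_const_pullback (f := a) (g := q₁) u (g ≫ s₁)
    (by rw [hus, Category.assoc, h₄])
  have hv : u₁ ≫ (const C).map (pullback.lift p₁ w₁ h₂) = f ≫ v := by
    refine const_pullback_hom_ext ?_ ?_
    · rw [Category.assoc, ← Functor.map_comp, pullback.lift_fst, Category.assoc, hv₁, h₃]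
    · rw [Category.assoc, ← Functor.map_comp, pullback.lift_snd, Category.assoc, hv₂, h₁,
        Category.assoc]
  obtain ⟨A₂, B₂, w₂, u₂, s₂, p₂, q₂, hw₂, k₁, k₂, k₃, k₄⟩ := hf _ u₁ v hv
  -- left properness lets `w₂` be pushed out along the cofibration part of `p₂`
  let d := MorphismProperty.factorizationData (cofibrations C) (trivialFibrations C) p₂
  have hd : weakEquivalences C d.p := d.hp.2
  have hinl : weakEquivalences C (pushout.inl d.i w₂) :=
    IsProperModelCategory.left_proper (IsPushout.of_hasPushout d.i w₂) d.hi hw₂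
  have e₁ : d.i ≫ d.p ≫ p₁ = w₂ ≫ q₂ ≫ pullback.fst a q₁ := by
    rw [d.fac_assoc, ← reassoc_of% k₂, pullback.lift_fst]
  have e₂ : d.i ≫ d.p ≫ w₁ = w₂ ≫ q₂ ≫ pullback.snd a q₁ := by
    rw [d.fac_assoc, ← reassoc_of% k₂, pullback.lift_snd]
  refine ⟨pushout d.i w₂, B₁, pushout.desc (d.p ≫ w₁) (q₂ ≫ pullback.snd _ _) e₂,
    s₂ ≫ (const C).map (pushout.inr _ _), s₁,
    pushout.desc (d.p ≫ p₁) (q₂ ≫ pullback.fst _ _) e₁, q₁, ?_, ?_, ?_, ?_, h₄⟩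
  · refine (weakEquivalences C).of_precomp _ _ hinl ?_
    rw [pushout.inl_desc]
    exact (weakEquivalences C).comp_mem _ _ hd hw₁
  · rw [Category.assoc, ← Functor.map_comp, pushout.inr_desc, Functor.map_comp, ← Category.assoc,
      k₄, hv₂]
  · refine pushout.hom_ext ?_ ?_
    · rw [pushout.inl_desc_assoc, pushout.inl_desc_assoc, Category.assoc, h₂, Category.assoc]
    · rw [pushout.inr_desc_assoc, pushout.inr_desc_assoc, Category.assoc, pullback.condition,
        Category.assoc]
  · rw [Category.assoc, ← Functor.map_comp, pushout.inr_desc, Functor.map_comp, ← Category.assoc,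
      k₄, hv₁]

/-- The target of an arrow of `C` under `f` is replaced by the source of a weak equivalence `w₁`
that comes from `g`; the composite with `w₁` is an arrow under `f ≫ g`. -/
theorem factorsThrough_weakEquivalences_of_postcomp {X Y Z : Pro C} {f : X ⟶ Y} {g : Y ⟶ Z}
    (hg : FactorsThrough (weakEquivalences C) g)
    (hfg : FactorsThrough (weakEquivalences C) (f ≫ g)) :
    FactorsThrough (weakEquivalences C) f := by
  intro A B a u s hus
  have hT := terminalIsTerminal.isTerminalObj (const C) _
  obtain ⟨B₁, Z₁, w₁, s₁, z₁, q₁, -, hw₁, h₁, -, h₃, -⟩ :=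
    hg (terminal.from B) s (hT.from Z) (hT.hom_ext _ _)
  obtain ⟨v, hv₁, hv₂⟩ := exists_lift_const_pullback (f := a) (g := q₁) u (f ≫ s₁)
    (by rw [hus, Category.assoc, h₃])
  obtain ⟨A₂, Z₂, w₂, u₂, z₂, p₂, q₂, hw₂, k₁, k₂, k₃, k₄⟩ :=
    hfg (pullback.snd a q₁ ≫ w₁) v z₁ (by
      rw [Functor.map_comp, ← Category.assoc, hv₂, Category.assoc, h₁, Category.assoc])
  -- right properness lets `w₁` be pulled back along the fibration part of `q₂`
  let d := MorphismProperty.factorizationData (trivialCofibrations C) (fibrations C) q₂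
  have hd : weakEquivalences C d.i := d.hi.2
  have hsnd : weakEquivalences C (pullback.snd w₁ d.p) :=
    IsProperModelCategory.right_proper (IsPullback.of_hasPullback w₁ d.p).flip d.hp hw₁
  have e : (p₂ ≫ pullback.snd a q₁) ≫ w₁ = (w₂ ≫ d.i) ≫ d.p := by
    rw [Category.assoc, k₂, Category.assoc, d.fac]
  obtain ⟨t, ht₁, ht₂⟩ := exists_lift_const_pullback (f := w₁) (g := d.p) s₁
    (g ≫ z₂ ≫ (const C).map d.i) (by
      rw [h₁, Category.assoc, Category.assoc, ← Functor.map_comp, d.fac, k₄])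
  refine ⟨A₂, pullback w₁ d.p, pullback.lift _ _ e, u₂, t, p₂ ≫ pullback.fst _ _,
    pullback.fst _ _ ≫ q₁, ?_, ?_, ?_, ?_, ?_⟩
  · refine (weakEquivalences C).of_postcomp _ _ hsnd ?_
    rw [pullback.lift_snd]
    exact (weakEquivalences C).comp_mem _ _ hw₂ hd
  · refine const_pullback_hom_ext ?_ ?_
    · rw [Category.assoc, ← Functor.map_comp, pullback.lift_fst, Category.assoc, ht₁,
        Functor.map_comp, ← Category.assoc, k₃, hv₂]
    · rw [Category.assoc, ← Functor.map_comp, pullback.lift_snd, Category.assoc, ht₂,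
        Functor.map_comp, ← Category.assoc, k₁, Category.assoc, Category.assoc]
  · rw [pullback.lift_fst_assoc, Category.assoc, Category.assoc, pullback.condition]
  · rw [Functor.map_comp, ← Category.assoc, k₃, hv₁]
  · rw [Functor.map_comp, ← Category.assoc, ht₁, h₃]

theorem hasTwoOutOfThreeProperty :
    (FactorsThrough (weakEquivalences C)).HasTwoOutOfThreeProperty where
  comp_mem _ _ hf hg := factorsThrough_weakEquivalences_comp hf hg
  of_postcomp _ _ hg hfg := factorsThrough_weakEquivalences_of_postcomp hg hfg
  of_precomp _ _ hf hfg := factorsThrough_weakEquivalences_of_precomp hf hfg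

end WeakEquivalences

/-! ### The strict model structure -/

/-- The morphisms that are essentially levelwise in the left class of a weak factorization system
of `C` are characterized by the left lifting property against the constant morphisms in the right
class. -/
theorem factorsThrough_eq_llp (L R : MorphismProperty C) [L.IsWeakFactorizationSystem R] :
    FactorsThrough L = (R.strictMap (const C)).llp := by
  ext X Y f
  rw [llp_strictMap_const_iff]
  constructor
  · intro hf A B p hp u s hus
    obtain ⟨A', B', w, u', s', a, b, hw, h₁, h₂, h₃, h₄⟩ := hf p u s hus
    have := MorphismProperty.hasLiftingProperty_of_wfs w p hw hp
    have sq : CommSq a w p b := ⟨h₂⟩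
    refine ⟨s' ≫ (const C).map sq.lift, ?_, ?_⟩
    · rw [← Category.assoc, ← h₁, Category.assoc, ← Functor.map_comp, sq.fac_left, h₃]
    · rw [Category.assoc, ← Functor.map_comp, sq.fac_right, h₄]
  · intro hf A B a u s hus
    let d := MorphismProperty.factorizationData L R a
    obtain ⟨t, ht₁, ht₂⟩ := hf d.p d.hp (u ≫ (const C).map d.i) s (by
      rw [Category.assoc, ← Functor.map_comp, d.fac, hus])
    exact ⟨A, d.Z, d.i, u, t, 𝟙 A, d.p, d.hi, ht₁.symm, by simp, by simp, ht₂⟩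

/-- `exists_factorization` for a weak factorization system, in which the right class is determined
by the left class. -/
theorem exists_wfs_factorization [HasLimits C] (L R : MorphismProperty C)
    [L.IsWeakFactorizationSystem R] {X Y : Pro C} (f : X ⟶ Y) :
    ∃ (Z : Pro C) (i : X ⟶ Z) (p : Z ⟶ Y), i ≫ p = f ∧ (R.strictMap (const C)).llp i ∧
      (R.strictMap (const C)).llp.rlp p ∧ FactorsThrough R p := by
  obtain rfl := MorphismProperty.rlp_eq_of_wfs L R
  exact exists_factorization L f

theorem isWeakFactorizationSystem [HasLimits C] (L R : MorphismProperty C)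
    [L.IsWeakFactorizationSystem R] :
    (R.strictMap (const C)).llp.IsWeakFactorizationSystem (R.strictMap (const C)).llp.rlp := by
  have : (R.strictMap (const C)).llp.HasFactorization (R.strictMap (const C)).llp.rlp :=
    ⟨fun f => by
      obtain ⟨Z, i, p, h, hi, hp, -⟩ := exists_wfs_factorization L R f
      exact ⟨{ Z := Z, i := i, p := p, fac := h, hi := hi, hp := hp }⟩⟩
  exact MorphismProperty.IsWeakFactorizationSystem.mk' _ _ fun i p hi hp => hp _ hi

/-- Morphisms with the right lifting property against the essentially levelwise morphisms in the
left class of a weak factorization system are essentially levelwise in the right class. -/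
theorem llp_rlp_le_factorsThrough [HasLimits C] (L R : MorphismProperty C)
    [L.IsWeakFactorizationSystem R] : (R.strictMap (const C)).llp.rlp ≤ FactorsThrough R := by
  intro X Y f hf
  obtain ⟨Z, i, p, h, hi, -, hp⟩ := exists_wfs_factorization L R f
  have := hf _ hi
  exact MorphismProperty.of_retract (RetractArrow.ofRightLiftingProperty h) hp

section ModelStructure

variable [ModelCategory C]

theorem factorsThrough_cofibrations :
    FactorsThrough (cofibrations C) = (constantTrivialFibrations C).llp :=
  factorsThrough_eq_llp _ (trivialFibrations C)

theorem factorsThrough_trivialCofibrations :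
    FactorsThrough (trivialCofibrations C) = (constantFibrations C).llp :=
  factorsThrough_eq_llp _ (fibrations C)

/-- A morphism that is essentially levelwise a cofibration, and also, for another level
representation, a weak equivalence, is essentially levelwise a trivial cofibration. -/
theorem factorsThrough_cofibrations_inf_weakEquivalences :
    FactorsThrough (cofibrations C) ⊓ FactorsThrough (weakEquivalences C) =
      FactorsThrough (trivialCofibrations C) := by
  apply le_antisymm
  · rintro X Y f ⟨hf, hf'⟩ A B a u s hus
    rw [factorsThrough_cofibrations, constantTrivialFibrations, llp_strictMap_const_iff] at hf
    obtain ⟨A', B', w, u', s', p, q, hw, h₁, h₂, h₃, h₄⟩ := hf' a u s hus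
    let d := MorphismProperty.factorizationData (cofibrations C) (trivialFibrations C) w
    have hd : weakEquivalences C d.i := by
      refine (weakEquivalences C).of_postcomp _ d.p d.hp.2 ?_
      rwa [d.fac]
    obtain ⟨t, ht₁, ht₂⟩ := hf d.p d.hp (u' ≫ (const C).map d.i) s' (by
      rw [Category.assoc, ← Functor.map_comp, d.fac, h₁])
    refine ⟨A', d.Z, d.i, u', t, p, d.p ≫ q, ⟨d.hi, hd⟩, ht₁.symm, ?_, h₃, ?_⟩
    · rw [d.fac_assoc, h₂]
    · rw [Functor.map_comp, ← Category.assoc, ht₂, h₄]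
  · exact le_inf (FactorsThrough.mono inf_le_left) (FactorsThrough.mono inf_le_right)

variable (C)

theorem essentiallyLevelwise_eq (W : MorphismProperty C) :
    essentiallyLevelwise W = FactorsThrough W := by
  ext X Y f
  exact essentiallyLevelwise_iff

/-- The strict model structure on `pro-C`. -/
@[reducible]
def strictModelCategory [HasLimits C] [HasColimits C] [IsProperModelCategory C] :
    ModelCategory (Pro C) :=
  letI : CategoryWithWeakEquivalences (Pro C) := ⟨essentiallyLevelwise (weakEquivalences C)⟩
  letI : CategoryWithCofibrations (Pro C) := ⟨essentiallyLevelwise (cofibrations C)⟩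
  letI : CategoryWithFibrations (Pro C) := ⟨(essentiallyLevelwise (cofibrations C) ⊓
    essentiallyLevelwise (weakEquivalences C)).rlp⟩
  have : HasLimits (Pro C) := hasLimits
  have : HasColimits (Pro C) := hasColimits
  have hW : weakEquivalences (Pro C) = FactorsThrough (weakEquivalences C) :=
    essentiallyLevelwise_eq C _
  have hC : cofibrations (Pro C) = (constantTrivialFibrations C).llp :=
    (essentiallyLevelwise_eq C _).trans factorsThrough_cofibrations
  have hTC : trivialCofibrations (Pro C) = (constantFibrations C).llp := by
    rw [trivialCofibrations, hC, hW, ← factorsThrough_cofibrations,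
      factorsThrough_cofibrations_inf_weakEquivalences, factorsThrough_trivialCofibrations]
  have hF : fibrations (Pro C) = (constantFibrations C).llp.rlp := by
    rw [← hTC]
    rfl
  have h₁ := isWeakFactorizationSystem (cofibrations C) (trivialFibrations C)
  have h₂ := isWeakFactorizationSystem (trivialCofibrations C) (fibrations C)
  have : (weakEquivalences (Pro C)).HasTwoOutOfThreeProperty :=
    hW ▸ hasTwoOutOfThreeProperty
  have hTF : trivialFibrations (Pro C) = (constantTrivialFibrations C).llp.rlp := by
    have hle : (constantTrivialFibrations C).llp.rlp ≤ FactorsThrough (weakEquivalences C) :=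
      (llp_rlp_le_factorsThrough (cofibrations C) (trivialFibrations C)).trans
        (FactorsThrough.mono inf_le_right)
    rw [trivialFibrations, hF, hW]
    refine le_antisymm ?_ (le_inf ?_ hle)
    · rintro X Y f ⟨hf, hf'⟩
      obtain ⟨Z, i, p, h, hi, hp, -⟩ :=
        exists_wfs_factorization (cofibrations C) (trivialFibrations C) f
      have hi' : (constantFibrations C).llp i := by
        rw [← factorsThrough_trivialCofibrations,
          ← factorsThrough_cofibrations_inf_weakEquivalences, factorsThrough_cofibrations]
        exact ⟨hi, factorsThrough_weakEquivalences_of_postcomp (hle _ hp) (by rwa [h])⟩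
      have := hf _ hi'
      exact MorphismProperty.of_retract (RetractArrow.ofRightLiftingProperty h) hp
    · refine MorphismProperty.antitone_rlp ?_
      rw [← factorsThrough_trivialCofibrations, ← factorsThrough_cofibrations]
      exact FactorsThrough.mono inf_le_left
  have : (cofibrations (Pro C)).IsWeakFactorizationSystem (trivialFibrations (Pro C)) := by
    rw [hC, hTF]
    exact h₁
  have : (trivialCofibrations (Pro C)).IsWeakFactorizationSystem (fibrations (Pro C)) := by
    rw [hTC, hF]
    exact h₂
  ModelCategory.mk' (Pro C)

end ModelStructure

open GeneralizedSmallObject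

/-! ### The cosmall object argument -/

theorem rlp_op {D : Type*} [Category D] (M : MorphismProperty D) : M.op.rlp = M.llp.op := by
  ext X Y f
  refine ⟨fun hf A B p hp => ?_, fun hf A B p hp => ?_⟩
  · exact HasLiftingProperty.iff_op.2 (hf p.op hp)
  · exact (HasLiftingProperty.iff_unop p f).2 (hf p.unop hp)

theorem llp_op {D : Type*} [Category D] (M : MorphismProperty D) : M.op.llp = M.rlp.op := by
  ext X Y f
  refine ⟨fun hf A B p hp => ?_, fun hf A B p hp => ?_⟩
  · exact HasLiftingProperty.iff_op.2 (hf p.op hp)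
  · exact (HasLiftingProperty.iff_unop f p).2 (hf p.unop hp)

/-- Constant pro-objects are cosmall for every cardinal and relative to every class, because
nonempty linear orders are filtered and constant pro-objects are cocompact. -/
theorem isKappaSmallRelativeTo_of_const {A : C} (κ : Cardinal.{v})
    (W : MorphismProperty (Pro C)ᵒᵖ) :
    IsKappaSmallRelativeTo κ (op ((const C).obj A)) W := by
  intro J _ _ _ _ _ F _ _
  infer_instance

/-- The map required for `f` is the second part of the factorization `f = i ≫ p`: a square from `f`
to a constant morphism in `R` extends along `i` by the lifting property of `i`. -/
theorem permitsCosmallObjectArgument [HasLimits C] (L R : MorphismProperty C)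
    [L.IsWeakFactorizationSystem R] :
    PermitsCosmallObjectArgument (R.strictMap (const C)) where
  exists_small := by
    have h {X Y : Pro C} {p : X ⟶ Y} (hp : R.strictMap (const C) p) (κ : Cardinal.{v})
        (W : MorphismProperty (Pro C)ᵒᵖ) : IsKappaSmallRelativeTo κ (op Y) W := by
      obtain ⟨-⟩ := hp
      exact isKappaSmallRelativeTo_of_const κ W
    exact ⟨0, fun A B i hi => h hi 0 _⟩
  exists_factorization f := by
    obtain ⟨Z, i, p, h, hi, hp, -⟩ := exists_wfs_factorization L R f.hom.unop
    refine ⟨Arrow.mk p.op, Arrow.homMk (𝟙 _) i.op ?_, ?_, fun m hm φ => ?_⟩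
    · exact Quiver.Hom.unop_inj ((Category.comp_id f.hom.unop).trans h.symm)
    · rw [rlp_op, llp_op]
      exact hp
    · have := hi _ hm
      have sq : CommSq φ.right.unop i m.hom.unop (p ≫ φ.left.unop) := ⟨by
        rw [← Category.assoc, h]
        exact congrArg Quiver.Hom.unop (Arrow.w φ).symm⟩
      refine ⟨Arrow.homMk φ.left sq.lift.op (Quiver.Hom.unop_inj sq.fac_right.symm), ?_⟩
      exact Arrow.hom_ext _ _ (Category.comp_id _) (Quiver.Hom.unop_inj sq.fac_left)

end Pro

theorem theorem6p1 {C : Type u} [Category.{v} C] [HasLimits C] [HasColimits C]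
    [ModelCategory C] [IsProperModelCategory C] :
    HasLimits (Pro C) ∧ HasColimits (Pro C) ∧
    ∃ S : ModelCategory (Pro C), Pro.IsStrictModelStructure C S ∧
      GeneralizedSmallObject.IsClassFibrantlyGeneratedBy (Pro C)
        (Pro.constantFibrations C) (Pro.constantTrivialFibrations C) ∧
      GeneralizedSmallObject.PermitsCosmallObjectArgument (Pro.constantFibrations C) ∧
      GeneralizedSmallObject.PermitsCosmallObjectArgument (Pro.constantTrivialFibrations C) := by
  have hM := Pro.permitsCosmallObjectArgument (trivialCofibrations C) (fibrations C)
  have hN := Pro.permitsCosmallObjectArgument (cofibrations C) (trivialFibrations C)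
  refine ⟨Pro.hasLimits, Pro.hasColimits, Pro.strictModelCategory C, ⟨rfl, rfl, rfl⟩,
    ?_, hM, hN⟩
  let := Pro.strictModelCategory C
  refine ⟨hM, ?_, hN, ?_⟩
  · rw [trivialFibrations_op, Pro.rlp_op, ← Pro.factorsThrough_trivialCofibrations,
      ← Pro.factorsThrough_cofibrations_inf_weakEquivalences, ← Pro.essentiallyLevelwise_eq,
      ← Pro.essentiallyLevelwise_eq]
    rfl
  · rw [fibrations_op, Pro.rlp_op, ← Pro.factorsThrough_cofibrations,
      ← Pro.essentiallyLevelwise_eq]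
    rfl
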